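/- Let $k$ be an algebraically closed field (of arbitrary characteristic) that is not an algebraic closure of a finite field. A $k$-variety is a reduced separated scheme of finite type over $k$, not necessarily irreducible, and a $k$-variety $X$ is called endo-free if every $k$-morphism $X\to X$ is either the identity or a constant map (a map whose value is a single $k$-rational point of $X$). (1) For every integer $d\ge 0$ there exists a smooth affine endo-free $k$-variety of dimension $d$. (2) For all integers $d\ge 0$ and $m\ge 5$ there are sets $\Delta_1,\dots,\Delta_d\subset\mathbb P^1(k)$ with exactly $m$ elements each, such that for every $j$ any two different $4$-element subsets $\{p_1,\dots,p_4\}$ and $\{q_1,\dots,q_4\}$ of $\Delta_j$ have different cross-ratios, for every ordering of the $p$'s and of the $q$'s, and such that the following hold: (a) every curve $\mathbb P^1\setminus\Delta_j$ is endo-free; (b) for $i\ne j$ every $k$-morphism $\mathbb P^1\setminus\Delta_i\to\mathbb P^1\setminus\Delta_j$ is constant; (c) the product $X=(\mathbb P^1\setminus\Delta_1)\times\cdots\times(\mathbb P^1\setminus\Delta_d)$ over $k$ is a smooth affine variety of dimension $d$, and for every $k$-endomorphism $\varphi$ of $X$ and every $j$ the $j$-th component $\mathrm{pr}_j\circ\varphi$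 is either the projection $\mathrm{pr}_j$ or constant. -/

import Mathlib

open CategoryTheory CategoryTheory.Limits AlgebraicGeometry

universe u

noncomputable section

namespace EndoFreeVarieties

variable (k : Type u) [Field k]

/-- The scheme `Spec k`. -/
abbrev SpecOf : Scheme.{u} := Spec (CommRingCat.of k)

variable {k}

/-- A `k`-variety: a reduced separated scheme of finite type over `k` (not necessarily
irreducible). -/
structure IsVariety (X : Over (SpecOf k)) : Prop where
  isReduced : IsReduced X.left
  isSeparated : IsSeparated X.hom
  locallyOfFiniteType : LocallyOfFiniteType X.hom
  quasiCompact : QuasiCompact X.hom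

/-- `X` is a smooth affine `k`-variety of dimension `d`. -/
structure IsSmoothAffineVarietyOfDim (X : Over (SpecOf k)) (d : ℕ) : Prop where
  isVariety : IsVariety X
  isAffine : IsAffine X.left
  smooth : Smooth X.hom
  dim_eq : topologicalKrullDim X.left = (d : WithBot ℕ∞)

/-- The constant morphism `X ⟶ Y` of `k`-schemes with value the `k`-rational point `y` of `Y`,
that is, the composition `X ⟶ Spec k ⟶ Y`. -/
def constMor (X : Over (SpecOf k)) {Y : Over (SpecOf k)}
    (y : Over.mk (𝟙 (SpecOf k)) ⟶ Y) : X ⟶ Y :=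
  Over.homMk X.hom ≫ y

/-- A morphism of `k`-schemes is constant if its value is a single `k`-rational point. -/
def IsConstant {X Y : Over (SpecOf k)} (f : X ⟶ Y) : Prop :=
  ∃ y : Over.mk (𝟙 (SpecOf k)) ⟶ Y, f = constMor X y

/-- `X` is endo-free if its only endomorphisms over `k` are the identity and the constant maps. -/
def EndoFree (X : Over (SpecOf k)) : Prop :=
  ∀ f : X ⟶ X, f = 𝟙 X ∨ IsConstant f

/-! ### The projective line and the complements of its finite subsets

The set of `k`-rational points of the projective line is `OnePoint k`, where `a : k` stands
for `(a : 1)` and the point at infinity stands for `(1 : 0)`. -/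

/-- Homogeneous coordinates of a point of the projective line. -/
def homCoord : OnePoint k → Fin 2 → k
  | none => ![1, 0]
  | some a => ![a, 1]

variable (k) in
/-- The standard grading of `k[x₀, x₁]`. -/
abbrev grading : ℕ → Submodule k (MvPolynomial (Fin 2) k) :=
  MvPolynomial.homogeneousSubmodule (Fin 2) k

instance instGradedAlgebraGrading : GradedAlgebra (grading k) :=
  MvPolynomial.gradedAlgebra

variable (k) in
/-- The projective line over `k`, as the `k`-scheme `Proj k[x₀, x₁]`. -/
def projLine : Over (SpecOf k) :=
  Over.mk (Proj.toSpecZero (grading k) ≫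
    Spec.map (CommRingCat.ofHom (algebraMap k (grading k 0))))

/-- The linear form `p₁ x₀ - p₀ x₁`, whose only zero on the projective line is
`p = (p₀ : p₁)`. -/
def linForm (p : OnePoint k) : MvPolynomial (Fin 2) k :=
  MvPolynomial.C (homCoord p 1) * MvPolynomial.X 0 -
    MvPolynomial.C (homCoord p 0) * MvPolynomial.X 1

/-- The open complement of the finite set `Δ` of rational points in the projective line: the
locus where none of the linear forms that define the points of `Δ` vanishes. -/
def complOpen (Δ : Finset (OnePoint k)) : (Proj (grading k)).Opens :=
  Proj.basicOpen (grading k) (∏ p ∈ Δ, linForm p)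

/-- The `k`-scheme `ℙ¹ ∖ Δ`. -/
def puncturedLine (Δ : Finset (OnePoint k)) : Over (SpecOf k) :=
  Over.mk ((complOpen Δ).ι ≫ (projLine k).hom)

/-- The determinant of the homogeneous coordinates of two points. -/
def bracket (p q : OnePoint k) : k :=
  homCoord p 0 * homCoord q 1 - homCoord p 1 * homCoord q 0

/-- The cross-ratio of four points of the projective line; for four distinct points no
denominator vanishes. -/
def crossRatio (p : Fin 4 → OnePoint k) : k :=
  (bracket (p 0) (p 2) * bracket (p 1) (p 3)) / (bracket (p 0) (p 3) * bracket (p 1) (p 2))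

/-- Two different four-point subsets of `Δ` never have the same cross-ratio, for any orderings of
their points. -/
def CrossRatioGeneric (Δ : Finset (OnePoint k)) : Prop :=
  ∀ p q : Fin 4 → OnePoint k, Function.Injective p → Function.Injective q →
    (∀ i, p i ∈ Δ) → (∀ i, q i ∈ Δ) → Set.range p ≠ Set.range q →
    crossRatio p ≠ crossRatio q

end EndoFreeVarieties

end

/-!
The argument rests on rigidity of the complement of a general finite set in the projective line.

*Maps between punctured lines.* Let a rational function on the line omit the `m` values of a set
`B` outside a set `E ∪ {∞}` with `|E| ≤ 2 m - 4`. If it is separable of degree `n`, counting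
zeros of the members of the pencil spanned by its numerator and denominator against zeros of
their Wronskian, a form of Riemann–Hurwitz (`card_mul_degree_lt`), gives `n = 1`. In general
`p`-th roots are extracted first, where `p` is the exponential characteristic. So a nonconstant
function is a power of Frobenius followed by a Möbius map (`exists_eq_frobenius_linear`,
`eq_const_or_frobenius_linear`), and choosing preimages of the points of `B` embeds `B` into
`E ∪ {∞}` compatibly with cross-ratios, up to the `p ^ r`-th power
(`crossRatio_of_isFrobImage`).

*General punctures.* As `k` is not the algebraic closure of a finite field, it contains an
element `t` that is not a root of unity, and the powers `t ^ (n p + 1)` have no common iterated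
`p`-th powers. The sets `Δ j` are built successively (`exists_generic_family`): each consists of
`∞, 0, 1`, a point `a` among these powers, unrelated to all cross-ratios of the earlier sets,
and further points keeping all cross-ratios generic. Then no power of Frobenius followed by a
Möbius map sends a subset of one `Δ i` onto another `Δ j`. If it sends `Δ j` onto itself, it is
a Möbius map, as a cross-ratio is not a root of unity, and it preserves every four-element
subset, so it is the identity (`frobRigid_of_generic`).

*Functions on the product.* Let `U` be the product of the curves `ℙ¹ ∖ Δ j`, or for `d ≥ 2` the
complement in it of at most two hyperplanes `∑ j, x j = s`, and let `f` be a regular function on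
`U` with values in `ℙ¹ ∖ Δ i`. A coordinate line meets `U` in the complement of `Δ j` and at
most two more points, and `m ≥ 5` makes the above bound apply. On a general line of the family
the additional points are in general position, so they are not among the chosen preimages, and
`f` is constant or the `i`-th coordinate on the line (`lineHom_eq_or`). Comparing lines, `f` is
constant or the `i`-th coordinate on `U` (`regular_eq_const_or_coord`,
`coordRing_eq_algebraMap_or_coord`).

*Conclusion.* The curves are affine (`puncturedLineIso`) and their product is the spectrum of an
explicit localization of a polynomial ring (`isLimitFanCoordRing`, `productIso`), so morphisms
to the factors are such functions; this gives the assertions about the product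
(`product_morphism`) and, by means of sections of the projections, about the curves
(`curve_morphism`). For `d ≥ 2` the product itself is not endo-free, since some components of an
endomorphism may be constant and others coordinates. Removing the hyperplanes `∑ j, x j = 0` and
`∑ j, x j = t`, where `t` is not a difference of elements of any `Δ j`, excludes such mixed
maps, as the sum of their components would take one of the removed values
(`endoFree_specAlg_coordRing`).
-/

noncomputable section

namespace EndoFreeVarieties

/-! ### Pencils spanned by two coprime polynomials -/

section OneVariable

open Polynomial

variable {k : Type*} [Field k]

/-- The determinant of two vectors of `k²`; it vanishes exactly when they are proportional. -/
def det2 (v v' : Fin 2 → k) : k := v 0 * v' 1 - v 1 * v' 0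

/-- The member `v₁ u - v₀ w` of the pencil spanned by `u` and `w`: for coprime `u` and `w` its
zeros in `k` are the points which the map `(u : w)` sends to the point `(v₀ : v₁)` of the
projective line. -/
def pencil (v : Fin 2 → k) (u w : k[X]) : k[X] := C (v 1) * u - C (v 0) * w

lemma det_mul_left_eq (v v' : Fin 2 → k) (u w : k[X]) :
    C (det2 v v') * u = C (v 0) * pencil v' u w - C (v' 0) * pencil v u w := by
  simp only [det2, pencil, map_sub, map_mul]; ring

lemma det_mul_right_eq (v v' : Fin 2 → k) (u w : k[X]) :
    C (det2 v v') * w = C (v 1) * pencil v' u w - C (v' 1) * pencil v u w := by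
  simp only [det2, pencil, map_sub, map_mul]; ring

lemma wronskian_pencil (v v' : Fin 2 → k) (u w : k[X]) :
    wronskian (pencil v u w) (pencil v' u w) = C (det2 v v') * wronskian u w := by
  simp only [det2, pencil, wronskian, map_sub, map_mul, derivative_mul, derivative_C, zero_mul,
    zero_add]
  ring

lemma natDegree_pencil_le (v : Fin 2 → k) (u w : k[X]) :
    (pencil v u w).natDegree ≤ max u.natDegree w.natDegree :=
  (natDegree_sub_le _ _).trans (max_le_max (natDegree_C_mul_le _ _) (natDegree_C_mul_le _ _))

lemma max_natDegree_le_of_pencil {v v' : Fin 2 → k} (h : det2 v v' ≠ 0) (u w : k[X]) :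
    max u.natDegree w.natDegree ≤
      max (pencil v u w).natDegree (pencil v' u w).natDegree := by
  have key : ∀ a b : k, (C a * pencil v' u w - C b * pencil v u w).natDegree ≤
      max (pencil v u w).natDegree (pencil v' u w).natDegree := fun a b => by
    rw [max_comm]
    exact (natDegree_sub_le _ _).trans
      (max_le_max (natDegree_C_mul_le _ _) (natDegree_C_mul_le _ _))
  refine max_le ?_ ?_
  · rw [← natDegree_C_mul h, det_mul_left_eq]; exact key _ _
  · rw [← natDegree_C_mul h, det_mul_right_eq]; exact key _ _

lemma eval_pencil_ne_zero {v v' : Fin 2 → k} (h : det2 v v' ≠ 0) {u w : k[X]}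
    (huw : IsCoprime u w) {x : k} (hx : (pencil v u w).eval x = 0) :
    (pencil v' u w).eval x ≠ 0 := by
  intro hx'
  have hu := congrArg (eval x) (det_mul_left_eq v v' u w)
  have hw := congrArg (eval x) (det_mul_right_eq v v' u w)
  simp only [eval_mul, eval_C, eval_sub, hx, hx', mul_zero, sub_zero, mul_eq_zero, h,
    false_or] at hu hw
  obtain ⟨a, b, hab⟩ := huw
  simpa [hu, hw] using congrArg (eval x) hab

lemma rootMultiplicity_pencil_le {v v' : Fin 2 → k} (h : det2 v v' ≠ 0) {u w : k[X]}
    (hW : wronskian u w ≠ 0) (x : k) :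
    (pencil v u w).rootMultiplicity x ≤ (wronskian u w).rootMultiplicity x + 1 := by
  have hd : (X - C x) ^ ((pencil v u w).rootMultiplicity x - 1) ∣
      C (det2 v v') * wronskian u w := by
    rw [← wronskian_pencil, wronskian]
    have h1 := pow_rootMultiplicity_dvd (pencil v u w) x
    refine dvd_sub (Dvd.dvd.mul_right ((pow_dvd_pow _ (Nat.sub_le _ _)).trans h1) _)
      (Dvd.dvd.mul_right (pow_sub_one_dvd_derivative_of_pow_dvd h1) _)
  rw [(isUnit_C.2 h.isUnit).dvd_mul_left] at hd
  have := (le_rootMultiplicity_iff hW).2 hd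
  omega

variable [IsAlgClosed k]

lemma sum_rootMultiplicity_eq {L : k[X]} (hL : L ≠ 0) (E : Finset k)
    (hE : ∀ x, L.eval x = 0 → x ∈ E) : ∑ x ∈ E, L.rootMultiplicity x = L.natDegree := by
  classical
  rw [(IsAlgClosed.splits L).natDegree_eq_card_roots, ← Multiset.toFinset_sum_count_eq]
  simp only [count_roots]
  symm
  refine Finset.sum_subset ?_ ?_
  · intro x hx
    exact hE x (by simpa [hL] using hx)
  · intro x _ hx
    refine rootMultiplicity_eq_zero ?_
    simpa [hL] using hx

lemma sum_rootMultiplicity_le {L : k[X]} (E : Finset k) :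
    ∑ x ∈ E, L.rootMultiplicity x ≤ L.natDegree := by
  classical
  rcases eq_or_ne L 0 with rfl | hL
  · simp
  rw [← sum_rootMultiplicity_eq hL (E ∪ L.roots.toFinset) (fun x hx => by simp [hL, hx])]
  exact Finset.sum_le_sum_of_subset Finset.subset_union_left

/-- The Riemann–Hurwitz estimate for the separable map `(u : w)` of degree
`n = max (deg u) (deg w)`: if the fibres over `N` points meet the affine line in at most `e`
points altogether, then `(N - 2) n < e`. Any two different members of the pencil have the
Wronskian of `u` and `w` up to a nonzero scalar, and a zero of order `r` of a member is a zero of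
order at least `r - 1` of it, so that the degree of the Wronskian bounds the ramification in these
fibres; the fibre over at most one of the points contains the point at infinity. -/
lemma card_mul_degree_lt {ι : Type*} [Fintype ι] (v : ι → Fin 2 → k)
    (hv : ∀ i j, i ≠ j → det2 (v i) (v j) ≠ 0) (hι : 2 ≤ Fintype.card ι) {u w : k[X]}
    (huw : IsCoprime u w) (hW : wronskian u w ≠ 0) (E : Finset k)
    (hE : ∀ i x, (pencil (v i) u w).eval x = 0 → x ∈ E) :
    Fintype.card ι * max u.natDegree w.natDegree <
      E.card + 2 * max u.natDegree w.natDegree := by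
  classical
  set n := max u.natDegree w.natDegree with hn
  have : Nontrivial ι := Fintype.one_lt_card_iff_nontrivial.1 hι
  have hL : ∀ i, pencil (v i) u w ≠ 0 := fun i h0 => by
    obtain ⟨j, hj⟩ := exists_ne i
    have := wronskian_pencil (v i) (v j) u w
    rw [h0, wronskian_zero_left, eq_comm, mul_eq_zero, C_eq_zero] at this
    exact this.elim (hv i j hj.symm) hW
  -- at each point at most one member of the pencil vanishes
  have hx : ∀ x, ∑ i, (pencil (v i) u w).rootMultiplicity x ≤
      (wronskian u w).rootMultiplicity x + 1 := fun x => by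
    by_cases h : ∃ i, (pencil (v i) u w).eval x = 0
    · obtain ⟨i, hi⟩ := h
      rw [Finset.sum_eq_single i (fun j _ hj => rootMultiplicity_eq_zero
        (eval_pencil_ne_zero (hv i j hj.symm) huw hi)) (by simp)]
      obtain ⟨j, hj⟩ := exists_ne i
      exact rootMultiplicity_pencil_le (hv i j hj.symm) hW x
    · push Not at h
      rw [Finset.sum_eq_zero fun i _ => rootMultiplicity_eq_zero (h i)]
      omega
  have h1 : ∑ i, (pencil (v i) u w).natDegree ≤ (wronskian u w).natDegree + E.card := by
    calc ∑ i, (pencil (v i) u w).natDegree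
        = ∑ i, ∑ x ∈ E, (pencil (v i) u w).rootMultiplicity x :=
          Finset.sum_congr rfl fun i _ => (sum_rootMultiplicity_eq (hL i) E (hE i)).symm
      _ = ∑ x ∈ E, ∑ i, (pencil (v i) u w).rootMultiplicity x := Finset.sum_comm
      _ ≤ ∑ x ∈ E, ((wronskian u w).rootMultiplicity x + 1) := Finset.sum_le_sum fun x _ => hx x
      _ ≤ _ := by
        rw [Finset.sum_add_distrib, Finset.sum_const, smul_eq_mul, mul_one]
        exact Nat.add_le_add_right (sum_rootMultiplicity_le E) _
  -- only the member of least degree can have degree below `n`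
  obtain ⟨i, hi⟩ := Finite.exists_min fun i => (pencil (v i) u w).natDegree
  have hdeg : ∀ j, j ≠ i → (pencil (v j) u w).natDegree = n := fun j hj => by
    refine le_antisymm (natDegree_pencil_le _ _ _) ?_
    have := max_natDegree_le_of_pencil (hv j i hj) u w
    rwa [max_eq_left (hi j)] at this
  have h2 : ∑ j, (pencil (v j) u w).natDegree =
      (pencil (v i) u w).natDegree + (Fintype.card ι - 1) * n := by
    rw [← Finset.add_sum_erase _ _ (Finset.mem_univ i),
      Finset.sum_congr rfl fun j hj => hdeg j (Finset.ne_of_mem_erase hj)]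
    simp [Finset.card_erase_of_mem]
  obtain ⟨j, hj⟩ := exists_ne i
  have h3 : (wronskian u w).natDegree < (pencil (v i) u w).natDegree + n := by
    rw [← hdeg j hj, ← natDegree_C_mul (hv i j hj.symm), ← wronskian_pencil]
    refine natDegree_wronskian_lt_add ?_
    rw [wronskian_pencil]
    exact mul_ne_zero (C_ne_zero.2 (hv i j hj.symm)) hW
  obtain ⟨c, hc⟩ : ∃ c, Fintype.card ι = c + 2 := ⟨_, (Nat.sub_add_cancel hι).symm⟩
  rw [hc] at h2 ⊢
  have : (c + 2 - 1) * n = c * n + n := by rw [show c + 2 - 1 = c + 1 by omega]; ring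
  have : (c + 2) * n = c * n + 2 * n := by ring
  omega

lemma exists_pow_eq_of_derivative_eq_zero (p : ℕ) [hp : Fact p.Prime] [CharP k p] {u : k[X]}
    (hu : derivative u = 0) : ∃ u₁ : k[X], u₁ ^ p = u := by
  refine ⟨(contract p u).map (frobeniusEquiv k p).symm.toRingHom, ?_⟩
  rw [← map_frobenius_expand, map_expand, map_map]
  have : (frobenius k p).comp (frobeniusEquiv k p).symm.toRingHom = RingHom.id k := by
    ext x; simp
  rw [this, Polynomial.map_id, expand_contract p hu hp.1.ne_zero]

/-- If the fibres of the nonconstant map `(u : w)` over `N` points meet the affine line in at most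
`2 N - 4` points, then the map is a power of Frobenius followed by a Möbius map. After extracting
`p`-th roots the map is separable, and then `card_mul_degree_lt` leaves only degree one. -/
theorem exists_eq_frobenius_linear (p : ℕ) [hp : ExpChar k p] {ι : Type*} [Fintype ι]
    (v : ι → Fin 2 → k) (hv : ∀ i j, i ≠ j → det2 (v i) (v j) ≠ 0)
    (hι : 2 ≤ Fintype.card ι) {u w : k[X]} (huw : IsCoprime u w)
    (hdeg : max u.natDegree w.natDegree ≠ 0) (E : Finset k)
    (hcard : E.card + 4 ≤ 2 * Fintype.card ι)
    (hE : ∀ i x, (pencil (v i) u w).eval x = 0 → x ∈ E) :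
    ∃ (r : ℕ) (α β γ δ : k), α * δ - β * γ ≠ 0 ∧ u = C α * X ^ p ^ r + C β ∧
      w = C γ * X ^ p ^ r + C δ := by
  induction hn : max u.natDegree w.natDegree using Nat.strong_induction_on
    generalizing v u w with
  | _ n ih =>
  by_cases hW : wronskian u w = 0
  · -- the pencil is inseparable: extract `p`-th roots
    rw [huw.wronskian_eq_zero_iff] at hW
    obtain ⟨hu, hw⟩ := hW
    cases hp with
    | zero =>
      exact absurd (by rw [derivative_eq_zero.1 hu, derivative_eq_zero.1 hw, max_self]) hdeg
    | prime hp =>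
      have : Fact p.Prime := ⟨hp⟩
      have : ExpChar k p := .prime hp
      obtain ⟨u₁, rfl⟩ := exists_pow_eq_of_derivative_eq_zero p hu
      obtain ⟨w₁, rfl⟩ := exists_pow_eq_of_derivative_eq_zero p hw
      have hmax : p * max u₁.natDegree w₁.natDegree = n := by
        rw [← hn, natDegree_pow, natDegree_pow, Nat.mul_max_mul_left]
      have h0 : max u₁.natDegree w₁.natDegree ≠ 0 := by
        rintro h; rw [h, mul_zero] at hmax; exact hdeg (hn.trans hmax.symm)
      have hlt : max u₁.natDegree w₁.natDegree < n := by
        rw [← hmax]; exact lt_mul_of_one_lt_left (Nat.pos_of_ne_zero h0) hp.one_lt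
      let v₁ : ι → Fin 2 → k := fun i s => (frobeniusEquiv k p).symm (v i s)
      have hv₁ : ∀ i s, v₁ i s ^ p = v i s := fun i s => frobeniusEquiv_symm_pow_p k p _
      obtain ⟨r, α, β, γ, δ, hne, h1, h2⟩ := ih _ hlt v₁ (u := u₁) (w := w₁)
        (fun i j hij h => hv i j hij (by
          have := congrArg (· ^ p) h
          simpa only [det2, sub_pow_expChar, mul_pow, hv₁, zero_pow hp.ne_zero] using this))
        ((IsCoprime.pow_iff hp.pos hp.pos).1 huw) h0
        (fun i x hx => hE i x (by
          have := congrArg (· ^ p) hx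
          simp only [pencil, eval_sub, eval_mul, eval_C, sub_pow_expChar, mul_pow, hv₁,
            zero_pow hp.ne_zero] at this
          simpa [pencil] using this)) rfl
      refine ⟨r + 1, α ^ p, β ^ p, γ ^ p, δ ^ p, ?_, ?_, ?_⟩
      · rw [← mul_pow, ← mul_pow, ← sub_pow_expChar]; exact pow_ne_zero _ hne
      · rw [h1, add_pow_expChar, mul_pow, ← pow_mul, pow_succ, C_pow, C_pow]
      · rw [h2, add_pow_expChar, mul_pow, ← pow_mul, pow_succ, C_pow, C_pow]
  · -- a separable map has degree one: `(N - 2) n < 2 N - 4` forces `n < 2`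
    have h1 := card_mul_degree_lt v hv hι huw hW E hE
    have hle : max u.natDegree w.natDegree ≤ 1 := by
      rw [hn] at h1 hdeg ⊢
      by_contra hcon
      obtain ⟨c, hc⟩ : ∃ c, Fintype.card ι = c + 2 := ⟨_, (Nat.sub_add_cancel hι).symm⟩
      obtain ⟨e, rfl⟩ : ∃ e, n = e + 2 := ⟨n - 2, by omega⟩
      rw [hc] at h1 hcard
      nlinarith [Nat.zero_le (c * e)]
    have hu := eq_X_add_C_of_natDegree_le_one ((le_max_left _ _).trans hle)
    have hw := eq_X_add_C_of_natDegree_le_one ((le_max_right _ _).trans hle)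
    refine ⟨0, _, _, _, _, ?_, by simpa using hu, by simpa using hw⟩
    intro hdet
    refine hW ?_
    rw [wronskian, hu, hw]
    have := congrArg C hdet
    simp only [map_sub, map_mul, map_zero] at this
    simp only [derivative_add, derivative_mul, derivative_C, derivative_X, zero_mul, mul_one,
      zero_add, add_zero]
    linear_combination -this

end OneVariable

/-! ### Möbius maps composed with powers of Frobenius -/

section Points

open Polynomial

variable {k : Type u} [Field k]

@[simp] lemma homCoord_infty_zero : homCoord (OnePoint.infty : OnePoint k) 0 = 1 := rfl
@[simp] lemma homCoord_infty_one : homCoord (OnePoint.infty : OnePoint k) 1 = 0 := rfl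
@[simp] lemma homCoord_coe_zero (a : k) : homCoord (a : OnePoint k) 0 = a := rfl
@[simp] lemma homCoord_coe_one (a : k) : homCoord (a : OnePoint k) 1 = 1 := rfl

lemma bracket_eq_zero_iff {p q : OnePoint k} : bracket p q = 0 ↔ p = q := by
  induction p using OnePoint.rec <;> induction q using OnePoint.rec <;>
    simp [bracket, sub_eq_zero, OnePoint.coe_ne_infty, OnePoint.infty_ne_coe]

lemma bracket_ne_zero {p q : OnePoint k} (h : p ≠ q) : bracket p q ≠ 0 :=
  mt bracket_eq_zero_iff.1 h

/-- The point `y` is the image of `x` under the `q`-th power map of coordinates followed by the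
Möbius map with matrix `(α, β; γ, δ)`. Homogeneous coordinates of the image are only determined up
to the factor `c`. -/
def IsFrobImage (q : ℕ) (α β γ δ : k) (x y : OnePoint k) : Prop :=
  ∃ c : k, c ≠ 0 ∧ c * homCoord y 0 = α * homCoord x 0 ^ q + β * homCoord x 1 ^ q ∧
    c * homCoord y 1 = γ * homCoord x 0 ^ q + δ * homCoord x 1 ^ q

/-- Möbius maps preserve cross-ratios, and the `p ^ r`-th power map raises them to the power
`p ^ r`. -/
lemma crossRatio_of_isFrobImage (p : ℕ) [ExpChar k p] {r : ℕ} {α β γ δ : k}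
    (hdet : α * δ - β * γ ≠ 0) {x y : Fin 4 → OnePoint k}
    (h : ∀ i, IsFrobImage (p ^ r) α β γ δ (x i) (y i)) :
    crossRatio y = crossRatio x ^ p ^ r := by
  choose c hc h0 h1 using h
  have key : ∀ i j, c i * c j * bracket (y i) (y j) =
      (α * δ - β * γ) * bracket (x i) (x j) ^ p ^ r := fun i j => by
    simp only [bracket, sub_pow_expChar_pow, mul_pow]
    linear_combination (c j * homCoord (y j) 1) * h0 i - (c j * homCoord (y j) 0) * h1 i
      + (α * homCoord (x i) 0 ^ p ^ r + β * homCoord (x i) 1 ^ p ^ r) * h1 j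
      - (γ * homCoord (x i) 0 ^ p ^ r + δ * homCoord (x i) 1 ^ p ^ r) * h0 j
  have hC : c 0 * c 1 * c 2 * c 3 ≠ 0 := by simp [hc]
  have hD : (α * δ - β * γ) ^ 2 ≠ 0 := pow_ne_zero _ hdet
  rw [crossRatio, crossRatio, div_pow, mul_pow, mul_pow, ← mul_div_mul_left _ _ hC,
    ← mul_div_mul_left (_ ^ _ * _ ^ _) _ hD]
  congr 1
  · linear_combination (c 1 * c 3 * bracket (y 1) (y 3)) * key 0 2 +
      ((α * δ - β * γ) * bracket (x 0) (x 2) ^ p ^ r) * key 1 3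
  · linear_combination (c 1 * c 2 * bracket (y 1) (y 2)) * key 0 3 +
      ((α * δ - β * γ) * bracket (x 0) (x 3) ^ p ^ r) * key 1 2

lemma IsFrobImage.eq_of_eq (p : ℕ) [ExpChar k p] {r : ℕ} {α β γ δ : k}
    {x y y' : OnePoint k} (h : IsFrobImage (p ^ r) α β γ δ x y)
    (h' : IsFrobImage (p ^ r) α β γ δ x y') : y = y' := by
  obtain ⟨c, hc, h0, h1⟩ := h
  obtain ⟨c', hc', h0', h1'⟩ := h'
  rw [← bracket_eq_zero_iff]
  refine (mul_eq_zero_iff_left (mul_ne_zero hc hc')).1 ?_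
  rw [bracket]
  linear_combination (c' * homCoord y' 1) * h0 - (c' * homCoord y' 0) * h1
      + (α * homCoord x 0 ^ p ^ r + β * homCoord x 1 ^ p ^ r) * h1'
      - (γ * homCoord x 0 ^ p ^ r + δ * homCoord x 1 ^ p ^ r) * h0'

variable [IsAlgClosed k]

/-- Let the rational function `P / h` avoid the finite set `B` of values outside `E`, where `E`
contains the poles and has at most `2 |B| - 4` elements. Then `P / h` is constant, or it is a
power of Frobenius followed by a Möbius map, and then every point of `B` is the image of a point
of `E` or of the point at infinity. The bound on `p ^ r` leaves only finitely many powers of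
Frobenius once the degrees of `P` and `h` are bounded. -/
theorem eq_const_or_frobenius_linear (p : ℕ) [hp : ExpChar k p] (B : Finset (OnePoint k))
    (hB2 : 2 ≤ B.card) (E : Finset k)
    (hcard : E.card + 4 ≤ 2 * B.card) {P h : k[X]} (hh : h ≠ 0)
    (hE : ∀ x, h.eval x = 0 → x ∈ E)
    (hP : ∀ x, x ∉ E → ∀ a : k, (a : OnePoint k) ∈ B → P.eval x ≠ a * h.eval x) :
    (∃ c, P = C c * h) ∨ ∃ (r : ℕ) (α β γ δ : k), α * δ - β * γ ≠ 0 ∧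
      p ^ r ≤ max P.natDegree h.natDegree ∧
      P * (C γ * X ^ p ^ r + C δ) = (C α * X ^ p ^ r + C β) * h ∧
      ∀ b ∈ B, ∃ x : OnePoint k, (x = OnePoint.infty ∨ ∃ e ∈ E, x = (e : OnePoint k)) ∧
        IsFrobImage (p ^ r) α β γ δ x b := by
  classical
  set t := EuclideanDomain.gcd P h
  have ht : t ≠ 0 := fun h0 => hh (EuclideanDomain.gcd_eq_zero_iff.1 h0).2
  obtain ⟨u, hu⟩ : t ∣ P := EuclideanDomain.gcd_dvd_left _ _
  obtain ⟨w, hw⟩ : t ∣ h := EuclideanDomain.gcd_dvd_right _ _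
  have huw : IsCoprime u w := by
    refine ⟨EuclideanDomain.gcdA P h, EuclideanDomain.gcdB P h, mul_left_cancel₀ ht ?_⟩
    have := EuclideanDomain.gcd_eq_gcd_ab P h
    change t = _ at this
    linear_combination -EuclideanDomain.gcdA P h * hu - EuclideanDomain.gcdB P h * hw - this
  -- `u / w` is `P / h` in lowest terms
  have hw0 : w ≠ 0 := by rintro rfl; exact hh (by rw [hw, mul_zero])
  by_cases hdeg : max u.natDegree w.natDegree = 0
  · left
    have hu' := eq_C_of_natDegree_eq_zero (Nat.le_zero.1 ((le_max_left _ _).trans hdeg.le))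
    have hw' := eq_C_of_natDegree_eq_zero (Nat.le_zero.1 ((le_max_right _ _).trans hdeg.le))
    have hw1 : w.coeff 0 ≠ 0 := fun h0 => hw0 (by rw [hw', h0, map_zero])
    refine ⟨u.coeff 0 / w.coeff 0, ?_⟩
    rw [hu, hw]
    nth_rewrite 1 [hu']
    nth_rewrite 2 [hw']
    rw [mul_left_comm, ← C_mul, div_mul_cancel₀ _ hw1]
  right
  have hpencil : ∀ b : B, ∀ x, (pencil (homCoord b.1) u w).eval x = 0 → x ∈ E := by
    rintro ⟨b, hb⟩ x hx
    induction b using OnePoint.rec with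
    | infty =>
      refine hE x ?_
      simp only [pencil, homCoord_infty_zero, homCoord_infty_one, map_zero, zero_mul, map_one,
        one_mul, zero_sub, eval_neg, neg_eq_zero] at hx
      rw [hw, eval_mul, hx, mul_zero]
    | coe a =>
      by_contra hxE
      refine hP x hxE a hb ?_
      simp only [pencil, homCoord_coe_zero, homCoord_coe_one, map_one,
        one_mul, eval_sub, eval_mul, eval_C, sub_eq_zero] at hx
      rw [hu, hw, eval_mul, eval_mul, hx]; ring
  obtain ⟨r, α, β, γ, δ, hdet, h1, h2⟩ := exists_eq_frobenius_linear p
    (fun b : B => homCoord b.1)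
    (fun i j hij => bracket_ne_zero fun h => hij (Subtype.ext h)) (by simpa using hB2) huw hdeg E
    (by simpa using hcard) hpencil
  have hq : p ^ r ≠ 0 := (pow_pos (expChar_pos k p) r).ne'
  refine ⟨r, α, β, γ, δ, hdet, ?_, ?_, ?_⟩
  · have hdu : u.natDegree ≤ P.natDegree ∨ u = 0 := by
      rcases eq_or_ne u 0 with h0 | h0
      · exact .inr h0
      · left; rw [hu, natDegree_mul ht h0]; omega
    by_cases hα : α = 0
    · have hγ : γ ≠ 0 := by rintro rfl; simp [hα] at hdet
      refine le_max_of_le_right ?_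
      have : w.natDegree = p ^ r := by
        rw [h2, natDegree_add_C, natDegree_C_mul_X_pow _ _ hγ]
      rw [hw, natDegree_mul ht hw0]; omega
    · refine le_max_of_le_left ?_
      have : u.natDegree = p ^ r := by
        rw [h1, natDegree_add_C, natDegree_C_mul_X_pow _ _ hα]
      have hu0 : u ≠ 0 := by rintro rfl; simp at this; omega
      rw [hu, natDegree_mul ht hu0]; omega
  · rw [← h1, ← h2, hu, hw]; ring
  · intro b hb
    set y₀ := homCoord b 0 with hy₀
    set y₁ := homCoord b 1 with hy₁
    have hy : y₀ ≠ 0 ∨ y₁ ≠ 0 := by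
      induction b using OnePoint.rec <;> simp [hy₀, hy₁]
    -- the preimage of `b` under the Möbius map, up to the `q`-th root
    by_cases hz : α * y₁ - γ * y₀ = 0
    · have hz0 : δ * y₀ - β * y₁ ≠ 0 := by
        intro hz0
        have e1 : (α * δ - β * γ) * y₀ = 0 := by linear_combination α * hz0 + β * hz
        have e2 : (α * δ - β * γ) * y₁ = 0 := by linear_combination γ * hz0 + δ * hz
        simp [hdet] at e1 e2
        simp [e1, e2] at hy
      refine ⟨_, .inl rfl, (α * δ - β * γ) / (δ * y₀ - β * y₁), div_ne_zero hdet hz0, ?_, ?_⟩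
      · rw [div_mul_eq_mul_div, div_eq_iff hz0]
        simp only [homCoord_infty_zero, homCoord_infty_one, one_pow, zero_pow hq]
        linear_combination β * hz
      · rw [div_mul_eq_mul_div, div_eq_iff hz0]
        simp only [homCoord_infty_zero, homCoord_infty_one, one_pow, zero_pow hq]
        linear_combination δ * hz
    · obtain ⟨e, he⟩ := IsAlgClosed.exists_pow_nat_eq
        ((δ * y₀ - β * y₁) / (α * y₁ - γ * y₀)) (Nat.pos_of_ne_zero hq)
      rw [eq_div_iff hz] at he
      have e1 : (α * e ^ p ^ r + β) * (α * y₁ - γ * y₀) = (α * δ - β * γ) * y₀ := by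
        linear_combination α * he
      have e2 : (γ * e ^ p ^ r + δ) * (α * y₁ - γ * y₀) = (α * δ - β * γ) * y₁ := by
        linear_combination γ * he
      refine ⟨e, .inr ⟨e, hpencil ⟨b, hb⟩ e ?_, rfl⟩,
        (α * δ - β * γ) / (α * y₁ - γ * y₀), div_ne_zero hdet hz, ?_, ?_⟩
      · simp only [pencil, eval_sub, eval_mul, eval_C, h1, h2, eval_add, eval_pow, eval_X]
        refine (mul_eq_zero_iff_right hz).1 ?_
        linear_combination y₁ * e1 - y₀ * e2
      · rw [div_mul_eq_mul_div, div_eq_iff hz]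
        simp only [homCoord_coe_zero, homCoord_coe_one, one_pow, mul_one]
        exact e1.symm
      · rw [div_mul_eq_mul_div, div_eq_iff hz]
        simp only [homCoord_coe_zero, homCoord_coe_one, one_pow, mul_one]
        exact e2.symm

end Points

/-! ### Generic cross-ratios -/

section Generic

open Polynomial

variable {k : Type u} [Field k]

lemma bracket_swap (p q : OnePoint k) : bracket q p = -bracket p q := by
  simp only [bracket]; ring

/-- The Plücker relation. -/
lemma bracket_plucker (a b c d : OnePoint k) :
    bracket a c * bracket b d - bracket a d * bracket b c = bracket a b * bracket c d := by
  simp only [bracket]; ring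

/-- The cross-ratio is invariant under the Klein four-group, which acts transitively on the four
positions; hence any given point may be moved to the first position. -/
lemma exists_perm_crossRatio (j : Fin 4) :
    ∃ κ : Equiv.Perm (Fin 4), κ 0 = j ∧
      ∀ x : Fin 4 → OnePoint k, crossRatio (x ∘ κ) = crossRatio x := by
  have h : ∀ a b c d : OnePoint k, bracket a b * bracket c d = bracket b a * bracket d c := by
    intro a b c d; simp only [bracket]; ring
  fin_cases j
  · exact ⟨1, rfl, fun x => rfl⟩
  · refine ⟨Equiv.swap 0 1 * Equiv.swap 2 3, by decide, fun x => ?_⟩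
    rw [crossRatio, crossRatio]
    simp only [Function.comp,
      show (Equiv.swap 0 1 * Equiv.swap 2 3 : Equiv.Perm (Fin 4)) 0 = 1 by decide,
      show (Equiv.swap 0 1 * Equiv.swap 2 3 : Equiv.Perm (Fin 4)) 1 = 0 by decide,
      show (Equiv.swap 0 1 * Equiv.swap 2 3 : Equiv.Perm (Fin 4)) 2 = 3 by decide,
      show (Equiv.swap 0 1 * Equiv.swap 2 3 : Equiv.Perm (Fin 4)) 3 = 2 by decide]
    rw [mul_comm, mul_comm (bracket (x 1) (x 2))]
  · refine ⟨Equiv.swap 0 2 * Equiv.swap 1 3, by decide, fun x => ?_⟩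
    rw [crossRatio, crossRatio]
    simp only [Function.comp,
      show (Equiv.swap 0 2 * Equiv.swap 1 3 : Equiv.Perm (Fin 4)) 0 = 2 by decide,
      show (Equiv.swap 0 2 * Equiv.swap 1 3 : Equiv.Perm (Fin 4)) 1 = 3 by decide,
      show (Equiv.swap 0 2 * Equiv.swap 1 3 : Equiv.Perm (Fin 4)) 2 = 0 by decide,
      show (Equiv.swap 0 2 * Equiv.swap 1 3 : Equiv.Perm (Fin 4)) 3 = 1 by decide]
    rw [h (x 2), h (x 2), mul_comm (bracket (x 1) (x 2))]
  · refine ⟨Equiv.swap 0 3 * Equiv.swap 1 2, by decide, fun x => ?_⟩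
    rw [crossRatio, crossRatio]
    simp only [Function.comp,
      show (Equiv.swap 0 3 * Equiv.swap 1 2 : Equiv.Perm (Fin 4)) 0 = 3 by decide,
      show (Equiv.swap 0 3 * Equiv.swap 1 2 : Equiv.Perm (Fin 4)) 1 = 2 by decide,
      show (Equiv.swap 0 3 * Equiv.swap 1 2 : Equiv.Perm (Fin 4)) 2 = 1 by decide,
      show (Equiv.swap 0 3 * Equiv.swap 1 2 : Equiv.Perm (Fin 4)) 3 = 0 by decide]
    rw [h (x 3), h (x 3), mul_comm (bracket (x 1) (x 3))]

/-- The cross-ratio as a function of its first point, the other three being fixed. -/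
lemma crossRatio_cons (a : OnePoint k) (t : Fin 3 → OnePoint k) :
    crossRatio (Fin.cons a t : Fin 4 → OnePoint k) =
      (bracket a (t 1) * bracket (t 0) (t 2)) / (bracket a (t 2) * bracket (t 0) (t 1)) := rfl

/-- As a function of its first point the cross-ratio is a Möbius map, hence injective away from
its pole `t 2`. -/
lemma crossRatio_cons_injOn {t : Fin 3 → OnePoint k} (ht : Function.Injective t)
    {a b : OnePoint k} (ha : a ≠ t 2) (hb : b ≠ t 2)
    (h : crossRatio (Fin.cons a t : Fin 4 → OnePoint k) =
      crossRatio (Fin.cons b t : Fin 4 → OnePoint k)) : a = b := by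
  have h01 := bracket_ne_zero (ht.ne (show (0 : Fin 3) ≠ 1 by decide))
  have h02 := bracket_ne_zero (ht.ne (show (0 : Fin 3) ≠ 2 by decide))
  have h12 := bracket_ne_zero (ht.ne (show (1 : Fin 3) ≠ 2 by decide))
  rw [crossRatio_cons, crossRatio_cons,
    div_eq_div_iff (mul_ne_zero (bracket_ne_zero ha) h01)
      (mul_ne_zero (bracket_ne_zero hb) h01)] at h
  rw [← bracket_eq_zero_iff]
  refine (mul_eq_zero_iff_right (mul_ne_zero (mul_ne_zero h12 h01) h02)).1 ?_
  have := bracket_plucker a b (t 1) (t 2)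
  linear_combination h - (bracket (t 0) (t 1) * bracket (t 0) (t 2)) * this

lemma eventually_crossRatio_cons_ne {t : Fin 3 → OnePoint k} (ht : Function.Injective t) (c : k) :
    ∀ᶠ a : k in Filter.cofinite, (a : OnePoint k) ≠ t 2 →
      crossRatio (Fin.cons (a : OnePoint k) t : Fin 4 → OnePoint k) ≠ c := by
  refine Set.Subsingleton.finite fun a ha b hb => ?_
  simp only [Set.mem_compl_iff, Set.mem_ofPred_eq, not_forall, not_not] at ha hb
  obtain ⟨ha, hac⟩ := ha
  obtain ⟨hb, hbc⟩ := hb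
  exact OnePoint.coe_injective (crossRatio_cons_injOn ht ha hb (hac.trans hbc.symm))

/-- The Möbius maps given by two different triples agree at finitely many points only: a Möbius
map that sends `∞, 0, 1` to given points is determined by them. -/
lemma eventually_crossRatio_cons_ne_cons {t t' : Fin 3 → OnePoint k}
    (ht : Function.Injective t) (ht' : Function.Injective t') (htt : t ≠ t') :
    ∀ᶠ a : k in Filter.cofinite, (a : OnePoint k) ≠ t 2 → (a : OnePoint k) ≠ t' 2 →
      crossRatio (Fin.cons (a : OnePoint k) t : Fin 4 → OnePoint k) ≠
        crossRatio (Fin.cons (a : OnePoint k) t' : Fin 4 → OnePoint k) := by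
  have h01 := bracket_ne_zero (ht.ne (show (0 : Fin 3) ≠ 1 by decide))
  have h02 := bracket_ne_zero (ht.ne (show (0 : Fin 3) ≠ 2 by decide))
  have h12 := bracket_ne_zero (ht.ne (show (1 : Fin 3) ≠ 2 by decide))
  have h01' := bracket_ne_zero (ht'.ne (show (0 : Fin 3) ≠ 1 by decide))
  have h02' := bracket_ne_zero (ht'.ne (show (0 : Fin 3) ≠ 2 by decide))
  have h12' := bracket_ne_zero (ht'.ne (show (1 : Fin 3) ≠ 2 by decide))
  set c := bracket (t 0) (t 2) * bracket (t' 0) (t' 1) with hc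
  set c' := bracket (t' 0) (t' 2) * bracket (t 0) (t 1) with hc'
  -- the quadratic form whose zeros are the points at which both cross-ratios agree
  let lin : OnePoint k → k[X] := fun q => C (homCoord q 1) * X - C (homCoord q 0)
  let f : k[X] := C c * (lin (t 1) * lin (t' 2)) - C c' * (lin (t' 1) * lin (t 2))
  by_cases hf : f = 0
  · -- if the form vanishes identically, its values at the points `t i` identify them with `t' i`
    exfalso
    have hF : ∀ z : OnePoint k, c * (bracket z (t 1) * bracket z (t' 2)) =
        c' * (bracket z (t' 1) * bracket z (t 2)) := by
      have hcoeff := fun n => congrArg (fun g => coeff g n) hf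
      have hexp : f = C (c * (homCoord (t 1) 1 * homCoord (t' 2) 1) -
            c' * (homCoord (t' 1) 1 * homCoord (t 2) 1)) * X ^ 2 +
          C (-c * (homCoord (t 1) 1 * homCoord (t' 2) 0 + homCoord (t 1) 0 * homCoord (t' 2) 1) +
            c' * (homCoord (t' 1) 1 * homCoord (t 2) 0 +
              homCoord (t' 1) 0 * homCoord (t 2) 1)) * X +
          C (c * (homCoord (t 1) 0 * homCoord (t' 2) 0) -
            c' * (homCoord (t' 1) 0 * homCoord (t 2) 0)) := by
        simp only [f, lin, map_sub, map_mul, map_add, map_neg]; ring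
      rw [hexp] at hcoeff
      have e2 := hcoeff 2
      have e1 := hcoeff 1
      have e0 := hcoeff 0
      simp only [coeff_add, coeff_C_mul, coeff_X_pow, coeff_X, coeff_C, coeff_zero] at e2 e1 e0
      norm_num at e2 e1 e0
      intro z
      simp only [bracket]
      linear_combination (homCoord z 0) ^ 2 * e2 + homCoord z 0 * homCoord z 1 * e1 +
        (homCoord z 1) ^ 2 * e0
    have hself : ∀ z : OnePoint k, bracket z z = 0 := fun z => bracket_eq_zero_iff.2 rfl
    have hc0 : c ≠ 0 := mul_ne_zero h02 h01'
    have hc0' : c' ≠ 0 := mul_ne_zero h02' h01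
    have e1 : t 1 = t' 1 := by
      have := hF (t 1)
      rw [hself, zero_mul, mul_zero, eq_comm] at this
      simpa [hc0', h12, bracket_eq_zero_iff] using this
    have e2 : t 2 = t' 2 := by
      have := hF (t 2)
      rw [hself, mul_zero, mul_zero, bracket_swap] at this
      simpa [hc0, h12, bracket_eq_zero_iff] using this
    have e0 : t 0 = t' 0 := by
      have := hF (t 0)
      rw [← e1, ← e2, mul_comm (bracket (t 0) (t 1)) (bracket (t 0) (t 2))] at this
      have hcc : c = c' := mul_right_cancel₀ (mul_ne_zero h02 h01) (by linear_combination this)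
      rw [← bracket_eq_zero_iff]
      refine (mul_eq_zero_iff_right h12).1 ?_
      rw [← bracket_plucker]
      rw [hc, hc', ← e1, ← e2] at hcc
      linear_combination -hcc
    exact htt (funext fun i => by fin_cases i <;> assumption)
  · refine (f.rootSet_finite k).subset ?_
    intro a ha
    simp only [Set.mem_compl_iff, Set.mem_ofPred_eq, not_forall, not_not] at ha
    obtain ⟨ha, ha', h⟩ := ha
    rw [crossRatio_cons, crossRatio_cons, div_eq_div_iff (mul_ne_zero (bracket_ne_zero ha) h01)
      (mul_ne_zero (bracket_ne_zero ha') h01')] at h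
    rw [mem_rootSet]
    refine ⟨hf, ?_⟩
    have hl : ∀ q : OnePoint k, (lin q).eval a = bracket (a : OnePoint k) q := fun q => by
      simp only [lin, bracket, eval_sub, eval_mul, eval_C, eval_X, homCoord_coe_zero,
        homCoord_coe_one]
      ring
    simp only [coe_aeval_eq_eval, f, eval_sub, eval_mul, eval_C, hl]
    linear_combination h

lemma finite_tuples {α : Type*} (n : ℕ) (A : Finset α) :
    {t : Fin n → α | ∀ i, t i ∈ A}.Finite :=
  Set.Finite.pi' fun _ => A.finite_toSet

/-- The set of cross-ratios of four different points of `A`, in all orderings. -/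
def crossRatioSet (A : Finset (OnePoint k)) : Set k :=
  {c | ∃ x : Fin 4 → OnePoint k, Function.Injective x ∧ (∀ i, x i ∈ A) ∧ crossRatio x = c}

lemma finite_crossRatioSet (A : Finset (OnePoint k)) : (crossRatioSet A).Finite := by
  refine ((finite_tuples 4 A).image crossRatio).subset ?_
  rintro c ⟨x, -, hx, rfl⟩
  exact ⟨x, hx, rfl⟩

lemma exists_cons_of_mem_range {A : Finset (OnePoint k)} {a : OnePoint k} [DecidableEq (OnePoint k)]
    {x : Fin 4 → OnePoint k} (hx : Function.Injective x) (hxA : ∀ i, x i ∈ insert a A)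
    (ha : a ∈ Set.range x) :
    ∃ t : Fin 3 → OnePoint k, Function.Injective t ∧ (∀ i, t i ∈ A) ∧
      Set.range x = insert a (Set.range t) ∧
      crossRatio x = crossRatio (Fin.cons a t : Fin 4 → OnePoint k) := by
  obtain ⟨j, rfl⟩ := ha
  obtain ⟨κ, hκ, hcr⟩ := exists_perm_crossRatio (k := k) j
  have hcons : (Fin.cons (x j) (fun i => x (κ i.succ)) : Fin 4 → OnePoint k) = x ∘ κ := by
    funext i
    refine Fin.cases ?_ (fun i => ?_) i
    · simp [hκ]
    · simp
  refine ⟨fun i => x (κ i.succ), fun i i' h => ?_, fun i => ?_, ?_, ?_⟩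
  · simpa using κ.injective (hx h)
  · refine Finset.mem_of_mem_insert_of_ne (hxA _) fun h => ?_
    rw [← hκ] at h
    exact Fin.succ_ne_zero i (κ.injective (hx h))
  · rw [← Fin.range_cons, hcons, κ.surjective.range_comp]
  · rw [hcons, hcr]

/-- A set with generic cross-ratios keeps this property when a point of the affine line, outside a
finite set, is added: the new cross-ratios are nonconstant functions of the new point, and
different ones belong to different triples of old points. -/
lemma CrossRatioGeneric.eventually_insert [DecidableEq (OnePoint k)] {A : Finset (OnePoint k)}
    (hA : CrossRatioGeneric A) :
    ∀ᶠ a : k in Filter.cofinite,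
      (a : OnePoint k) ∉ A ∧ CrossRatioGeneric (insert (a : OnePoint k) A) := by
  have h1 : ∀ᶠ a : k in Filter.cofinite, (a : OnePoint k) ∉ A := by
    refine (A.finite_toSet.preimage OnePoint.coe_injective.injOn).subset ?_
    intro a ha; simpa using ha
  have h2 : ∀ᶠ a : k in Filter.cofinite, ∀ t ∈ {t : Fin 3 → OnePoint k | ∀ i, t i ∈ A},
      ∀ c ∈ crossRatioSet A, Function.Injective t → (a : OnePoint k) ≠ t 2 →
      crossRatio (Fin.cons (a : OnePoint k) t : Fin 4 → OnePoint k) ≠ c := by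
    rw [Filter.eventually_all_finite (finite_tuples 3 A)]
    intro t _
    rw [Filter.eventually_all_finite (finite_crossRatioSet A)]
    intro c _
    by_cases ht : Function.Injective t
    · simpa [ht] using eventually_crossRatio_cons_ne ht c
    · simp [ht]
  have h3 : ∀ᶠ a : k in Filter.cofinite, ∀ t ∈ {t : Fin 3 → OnePoint k | ∀ i, t i ∈ A},
      ∀ t' ∈ {t : Fin 3 → OnePoint k | ∀ i, t i ∈ A},
      Function.Injective t → Function.Injective t' → t ≠ t' →
      (a : OnePoint k) ≠ t 2 → (a : OnePoint k) ≠ t' 2 →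
      crossRatio (Fin.cons (a : OnePoint k) t : Fin 4 → OnePoint k) ≠
        crossRatio (Fin.cons (a : OnePoint k) t' : Fin 4 → OnePoint k) := by
    rw [Filter.eventually_all_finite (finite_tuples 3 A)]
    intro t _
    rw [Filter.eventually_all_finite (finite_tuples 3 A)]
    intro t' _
    by_cases h : Function.Injective t ∧ Function.Injective t' ∧ t ≠ t'
    · filter_upwards [eventually_crossRatio_cons_ne_cons h.1 h.2.1 h.2.2] with a ha _ _ _
      exact ha
    · exact .of_forall fun a h1 h2 h3 => absurd ⟨h1, h2, h3⟩ h
  filter_upwards [h1, h2, h3] with a h1 h2 h3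
  have hne : ∀ {y : OnePoint k}, y ∈ A → (a : OnePoint k) ≠ y := fun hy h => h1 (h ▸ hy)
  have hmem : ∀ {x : Fin 4 → OnePoint k}, (∀ i, x i ∈ insert (a : OnePoint k) A) →
      (a : OnePoint k) ∉ Set.range x → ∀ i, x i ∈ A := fun hx hr i =>
    Finset.mem_of_mem_insert_of_ne (hx i) fun h => hr ⟨i, h⟩
  refine ⟨h1, fun x y hx hy hxA hyA hxy => ?_⟩
  by_cases hax : (a : OnePoint k) ∈ Set.range x <;> by_cases hay : (a : OnePoint k) ∈ Set.range y
  · obtain ⟨t, ht, htA, hxr, hxc⟩ := exists_cons_of_mem_range hx hxA hax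
    obtain ⟨t', ht', htA', hyr, hyc⟩ := exists_cons_of_mem_range hy hyA hay
    rw [hxc, hyc]
    refine h3 t htA t' htA' ht ht' ?_ (hne (htA 2)) (hne (htA' 2))
    rintro rfl
    exact hxy (hxr.trans hyr.symm)
  · obtain ⟨t, ht, htA, hxr, hxc⟩ := exists_cons_of_mem_range hx hxA hax
    rw [hxc]
    exact h2 t htA _ ⟨y, hy, hmem hyA hay, rfl⟩ ht (hne (htA 2))
  · obtain ⟨t, ht, htA, hxr, hxc⟩ := exists_cons_of_mem_range hy hyA hay
    rw [hxc]
    exact (h2 t htA _ ⟨x, hx, hmem hxA hax, rfl⟩ ht (hne (htA 2))).symm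
  · exact hA x y hx hy (hmem hxA hax) (hmem hyA hay) hxy

/-- A set of at most four points has at most one four-element subset. -/
lemma crossRatioGeneric_of_card_le {A : Finset (OnePoint k)} (hA : A.card ≤ 4) :
    CrossRatioGeneric A := by
  classical
  intro x y hx hy hxA hyA hxy
  have key : ∀ z : Fin 4 → OnePoint k, Function.Injective z → (∀ i, z i ∈ A) →
      Set.range z = A := fun z hz hzA => by
    have h1 : Finset.univ.image z ⊆ A := by
      intro y hy; obtain ⟨i, -, rfl⟩ := Finset.mem_image.1 hy; exact hzA i
    have h2 := Finset.eq_of_subset_of_card_le h1 (by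
      rw [Finset.card_image_of_injective _ hz]; simpa using hA)
    rw [← h2]; simp
  exact absurd ((key x hx hxA).trans (key y hy hyA).symm) hxy

lemma exists_crossRatioGeneric_superset [Infinite k] {A : Finset (OnePoint k)}
    (hA : CrossRatioGeneric A) {m : ℕ} (hm : A.card ≤ m) :
    ∃ B : Finset (OnePoint k), A ⊆ B ∧ B.card = m ∧ CrossRatioGeneric B := by
  classical
  induction m, hm using Nat.le_induction with
  | base => exact ⟨A, subset_rfl, rfl, hA⟩
  | succ m _ ih =>
    obtain ⟨B, hAB, hB, hg⟩ := ih
    obtain ⟨a, ha, hga⟩ := hg.eventually_insert.exists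
    exact ⟨insert (a : OnePoint k) B, hAB.trans (Finset.subset_insert _ _),
      by rw [Finset.card_insert_of_notMem ha, hB], hga⟩

end Generic

/-! ### Families of punctures without Frobenius–Möbius coverings -/

section Family

open Polynomial

variable {k : Type u} [Field k]

/-- No power of Frobenius followed by a Möbius map sends a subset of `A` onto `B`. -/
def NoFrobCover (p : ℕ) (A B : Finset (OnePoint k)) : Prop :=
  ∀ (r : ℕ) (α β γ δ : k), α * δ - β * γ ≠ 0 →
    ¬ ∀ b ∈ B, ∃ x ∈ A, IsFrobImage (p ^ r) α β γ δ x b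

/-- The identity is the only power of Frobenius followed by a Möbius map that sends `A` onto
itself; the Möbius map is the identity when its matrix is scalar. -/
def FrobRigid (p : ℕ) (A : Finset (OnePoint k)) : Prop :=
  ∀ (r : ℕ) (α β γ δ : k), α * δ - β * γ ≠ 0 →
    (∀ b ∈ A, ∃ x ∈ A, IsFrobImage (p ^ r) α β γ δ x b) →
    p ^ r = 1 ∧ β = 0 ∧ γ = 0 ∧ α = δ

/-- Neither of `a` and `s` is obtained from the other by iterating `x ↦ x ^ p`. -/
def FrobIndep (p : ℕ) (a s : k) : Prop := ∀ r : ℕ, a ^ p ^ r ≠ s ∧ s ^ p ^ r ≠ a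

/-- A cross-ratio `a` of `B` would be the `p ^ r`-th power of a cross-ratio of `A`. -/
lemma noFrobCover_of_frobIndep_left (p : ℕ) [ExpChar k p] {A B : Finset (OnePoint k)} {a : k}
    (ha : a ∈ crossRatioSet B) (h : ∀ s ∈ crossRatioSet A, FrobIndep p a s) :
    NoFrobCover p A B := by
  intro r α β γ δ hdet hcov
  obtain ⟨y, hy, hyB, rfl⟩ := ha
  choose x hxA hx using fun i => hcov (y i) (hyB i)
  refine (h (crossRatio x) ⟨x, fun i j hij => ?_, hxA, rfl⟩ r).2
    (crossRatio_of_isFrobImage p hdet hx).symm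
  have := hx i
  rw [hij] at this
  exact hy (this.eq_of_eq p (hx j))

/-- A map of a subset of `A` onto `B` is a bijection of `A` with `B` when the cardinalities agree,
so that a cross-ratio of `B` would be the `p ^ r`-th power of the cross-ratio `a` of `A`. -/
lemma noFrobCover_of_frobIndep_right (p : ℕ) [ExpChar k p] {A B : Finset (OnePoint k)}
    (hAB : A.card = B.card) {a : k}
    (ha : a ∈ crossRatioSet A) (h : ∀ s ∈ crossRatioSet B, FrobIndep p a s) :
    NoFrobCover p A B := by
  intro r α β γ δ hdet hcov
  choose τ hτA hτ using hcov
  let σ : B → A := fun b => ⟨τ b.1 b.2, hτA b.1 b.2⟩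
  have hinj : Function.Injective σ := fun b c hbc => by
    have h1 := hτ b.1 b.2
    rw [show τ b.1 b.2 = τ c.1 c.2 from congrArg Subtype.val hbc] at h1
    exact Subtype.ext (h1.eq_of_eq p (hτ c.1 c.2))
  have hbij := (Fintype.bijective_iff_injective_and_card σ).2 ⟨hinj, by simpa using hAB.symm⟩
  obtain ⟨x, hx, hxA, rfl⟩ := ha
  choose y hy using fun i => hbij.2 ⟨x i, hxA i⟩
  have hy' : ∀ i, τ (y i).1 (y i).2 = x i := fun i => congrArg Subtype.val (hy i)
  refine (h (crossRatio fun i => (y i).1) ⟨_, fun i j hij => hx ?_, fun i => (y i).2, rfl⟩ r).1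
    (crossRatio_of_isFrobImage p hdet (fun i => hy' i ▸ hτ (y i).1 (y i).2)).symm
  rw [← hy' i, ← hy' j, Subtype.ext hij]

lemma exists_tuple_avoiding {α : Type*} {A : Finset α} (hA : 5 ≤ A.card) {b c : α} (hb : b ∈ A)
    (hbc : c ≠ b) : ∃ x : Fin 4 → α, Function.Injective x ∧ (∀ i, x i ∈ A) ∧ x 0 = b ∧
      c ∉ Set.range x := by
  classical
  have hcard : 3 ≤ ((A.erase b).erase c).card := by
    have h1 := Finset.card_erase_of_mem hb
    have h2 := Finset.pred_card_le_card_erase (s := A.erase b) (a := c)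
    omega
  obtain ⟨T, hT, hT3⟩ := Finset.exists_subset_card_eq hcard
  let e := (T.equivFinOfCardEq hT3).symm
  have he : ∀ i, (e i).1 ≠ c ∧ (e i).1 ≠ b ∧ (e i).1 ∈ A := fun i => by
    have := hT (e i).2
    simpa only [Finset.mem_erase] using this
  refine ⟨Fin.cons b fun i => (e i).1, ?_, ?_, rfl, ?_⟩
  · rw [Fin.cons_injective_iff]
    refine ⟨?_, fun i j hij => e.injective (Subtype.ext hij)⟩
    rintro ⟨i, hi⟩
    exact (he i).2.1 hi
  · intro i
    refine Fin.cases hb (fun i => (he i).2.2) i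
  · rintro ⟨i, hi⟩
    revert hi
    refine Fin.cases (fun h => hbc h.symm) (fun i h => (he i).1 h) i

/-- A set of at least five points with generic cross-ratios, one of which is not a root of unity,
is rigid. The map permutes the set, so an iterate of it is the identity on the set and some
positive power of `p ^ r` fixes the cross-ratio `a`: hence `p ^ r = 1`. A Möbius map that permutes
the set preserves every cross-ratio, so it maps every four-element subset to itself, and with five
points it fixes each point. -/
lemma frobRigid_of_generic (p : ℕ) [hp : ExpChar k p] {A : Finset (OnePoint k)} (hA : 5 ≤ A.card)
    (hg : CrossRatioGeneric A) (h0 : ((0 : k) : OnePoint k) ∈ A) (h1 : ((1 : k) : OnePoint k) ∈ A)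
    (hi : OnePoint.infty ∈ A) {a : k} (ha : a ∈ crossRatioSet A) (ha0 : a ≠ 0)
    (hord : ¬ IsOfFinOrder a) : FrobRigid p A := by
  intro r α β γ δ hdet hcov
  choose τ hτA hτ using hcov
  let σ : A → A := fun b => ⟨τ b.1 b.2, hτA b.1 b.2⟩
  have hinj : Function.Injective σ := fun b c hbc => by
    have h1 := hτ b.1 b.2
    rw [show τ b.1 b.2 = τ c.1 c.2 from congrArg Subtype.val hbc] at h1
    exact Subtype.ext (h1.eq_of_eq p (hτ c.1 c.2))
  let e : Equiv.Perm A := Equiv.ofBijective σ (Finite.injective_iff_bijective.1 hinj)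
  have hcr : ∀ x : Fin 4 → A, crossRatio (fun i => (x i).1) =
      crossRatio (fun i => (e (x i)).1) ^ p ^ r := fun x =>
    crossRatio_of_isFrobImage p hdet fun i => hτ (x i).1 (x i).2
  have hiter : ∀ (n : ℕ) (x : Fin 4 → A), crossRatio (fun i => (x i).1) =
      crossRatio (fun i => ((e ^ n) (x i)).1) ^ (p ^ r) ^ n := by
    intro n
    induction n with
    | zero => intro x; simp
    | succ n ih =>
      intro x
      rw [ih, hcr, ← pow_mul, pow_succ (p ^ r), mul_comm (p ^ r)]
      simp only [pow_succ' e, Equiv.Perm.mul_apply]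
  -- if the permutation `e` has order `N`, then `a = a ^ (p ^ r) ^ N`, but `a` is not a root
  -- of unity
  have hq : p ^ r = 1 := by
    obtain ⟨x, hx, hxA, rfl⟩ := ha
    have h := hiter (orderOf e) fun i => ⟨x i, hxA i⟩
    rw [pow_orderOf_eq_one, ← pow_mul] at h
    simp only [Equiv.Perm.coe_one, id] at h
    have hN : 0 < p ^ (r * orderOf e) := pow_pos (expChar_pos k p) _
    by_contra hr
    have h2 : crossRatio x ^ (p ^ (r * orderOf e) - 1) = 1 := by
      refine mul_right_cancel₀ ha0 ?_
      rw [← pow_succ, Nat.sub_add_cancel hN, one_mul]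
      exact h.symm
    refine hord (isOfFinOrder_iff_pow_eq_one.2 ⟨_, ?_, h2⟩)
    have : p ^ (r * orderOf e) ≠ 1 := by
      rw [pow_mul]
      exact fun h => hr ((Nat.pow_eq_one.1 h).resolve_right (orderOf_pos e).ne')
    omega
  refine ⟨hq, ?_⟩
  rw [hq] at hτ hcr
  have hfix : ∀ b : A, e b = b := fun b => by
    by_contra hb
    -- four points including `b`, but not its image, form a subset that is not preserved
    obtain ⟨x, hx, hxA, hx0, hxb⟩ := exists_tuple_avoiding hA b.2
      (c := (e b).1) (fun h => hb (Subtype.ext h))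
    refine hg x (fun i => (e ⟨x i, hxA i⟩).1) hx (fun i j hij => ?_) hxA (fun i => (e _).2) ?_ ?_
    · exact hx (congrArg Subtype.val (e.injective (Subtype.ext hij)))
    · intro h
      refine hxb (h ▸ ⟨0, ?_⟩)
      exact congrArg (fun z => (e z).1) (Subtype.ext hx0)
    · simpa using hcr fun i => ⟨x i, hxA i⟩
  -- a Möbius map that fixes `0`, `1` and `∞` is the identity
  have hfix' : ∀ b ∈ A, IsFrobImage 1 α β γ δ b b := fun b hb => by
    have := hτ b hb
    rwa [show τ b hb = b from congrArg Subtype.val (hfix ⟨b, hb⟩)] at this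
  obtain ⟨c, -, e1, e2⟩ := hfix' _ h0
  obtain ⟨c', -, e1', e2'⟩ := hfix' _ hi
  obtain ⟨c'', -, e1'', e2''⟩ := hfix' _ h1
  simp only [homCoord_coe_zero, homCoord_coe_one, homCoord_infty_one, homCoord_infty_zero, pow_one,
    mul_zero, mul_one, zero_add, add_zero] at e1 e2 e1' e2' e1'' e2''
  have hβ : β = 0 := e1.symm
  have hγ : γ = 0 := e2'.symm
  refine ⟨hβ, hγ, ?_⟩
  rw [hβ] at e1''
  rw [hγ] at e2''
  linear_combination e2'' - e1''

/-- If all nonzero elements are roots of unity, then the characteristic is positive, as `2` is a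
root of unity, and `k` is algebraic over its prime field. -/
lemma exists_not_isOfFinOrder [IsAlgClosed k]
    (hk : ∀ (F : Type u) [Field F] [Finite F] [Algebra F k], ¬ IsAlgClosure F k) :
    ∃ t : kˣ, ¬ IsOfFinOrder t := by
  by_contra! hcon
  obtain ⟨p, hp⟩ := CharP.exists k
  rcases CharP.char_is_prime_or_zero k p with hprime | rfl
  · have : Fact p.Prime := ⟨hprime⟩
    let F : Subfield k := (ZMod.castHom (dvd_refl p) k).fieldRange
    have : Finite F := inferInstanceAs (Finite (Set.range (ZMod.castHom (dvd_refl p) k)))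
    refine hk F ⟨inferInstance, ⟨fun x => ?_⟩⟩
    rcases eq_or_ne x 0 with rfl | hx
    · exact isAlgebraic_zero
    obtain ⟨n, hn, h⟩ := isOfFinOrder_iff_pow_eq_one.1 (hcon (Units.mk0 x hx))
    refine ⟨X ^ n - 1, (monic_X_pow_sub_C 1 hn.ne').ne_zero, ?_⟩
    have := congrArg Units.val h
    simpa [sub_eq_zero] using this
  · have : CharZero k := CharP.charP_to_charZero k
    obtain ⟨n, hn, h⟩ := isOfFinOrder_iff_pow_eq_one.1 (hcon (Units.mk0 2 two_ne_zero))
    have h' : (2 : k) ^ n = 1 := by simpa using congrArg Units.val h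
    have : (2 : ℕ) ^ n = 1 := by exact_mod_cast h'
    exact (Nat.one_lt_two_pow hn.ne').ne' this

/-- The numbers `n p + 1` are prime to `p`, so that they are determined by their products with
powers of `p`. -/
lemma eq_of_mul_pow_eq {p : ℕ} (hp : p = 1 ∨ p.Prime) {n n' a b : ℕ}
    (h : (n * p + 1) * p ^ a = (n' * p + 1) * p ^ b) : n = n' := by
  rcases hp with rfl | hp
  · simpa using h
  wlog hab : a ≤ b generalizing n n' a b
  · exact (this h.symm (le_of_not_ge hab)).symm
  obtain ⟨c, rfl⟩ := Nat.exists_eq_add_of_le hab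
  rw [pow_add, mul_comm (p ^ a), ← mul_assoc] at h
  have h' := Nat.eq_of_mul_eq_mul_right (pow_pos hp.pos a) h
  rcases Nat.eq_zero_or_pos c with rfl | hc
  · simpa [hp.ne_zero] using h'
  · exfalso
    have : p ∣ n * p + 1 := h' ▸ Dvd.dvd.mul_left (dvd_pow_self p hc.ne') _
    rw [Nat.dvd_add_right (Dvd.intro_left n rfl)] at this
    exact hp.one_lt.ne' (Nat.dvd_one.1 this)

/-- Among the elements `t ^ (n p + 1)`, where `t` is not a root of unity, no two have a common
`p`-power iterate, so each `s` in the finite set `S` excludes at most one of them. -/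
lemma exists_frobIndep (p : ℕ) [hp : ExpChar k p] {t : kˣ} (ht : ¬ IsOfFinOrder t) {S : Set k}
    (hS : S.Finite) : ∃ a : k, a ≠ 0 ∧ ¬ IsOfFinOrder a ∧ ∀ s ∈ S, FrobIndep p a s := by
  have hpp : p = 1 ∨ p.Prime := by
    cases hp with
    | zero => exact .inl rfl
    | prime h => exact .inr h
  have hfin : ∀ᶠ n : ℕ in Filter.cofinite, ∀ s ∈ S, FrobIndep p ((t : k) ^ (n * p + 1)) s := by
    rw [Filter.eventually_all_finite hS]
    intro s _
    refine Set.Subsingleton.finite fun n hn n' hn' => ?_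
    have key : ∀ n : ℕ, n ∈ {n : ℕ | FrobIndep p ((t : k) ^ (n * p + 1)) s}ᶜ →
        ∃ x y, ((t : k) ^ (n * p + 1)) ^ p ^ x = s ^ p ^ y := by
      intro n hn
      simp only [FrobIndep, Set.mem_compl_iff, Set.mem_ofPred_eq, not_forall] at hn
      obtain ⟨r, hr⟩ := hn
      by_cases h : ((t : k) ^ (n * p + 1)) ^ p ^ r = s
      · exact ⟨r, 0, by simpa using h⟩
      · simp only [not_and_or, not_not, ne_eq, h, false_or] at hr
        exact ⟨0, r, by simpa using hr.symm⟩
    obtain ⟨x, y, h⟩ := key n hn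
    obtain ⟨x', y', h'⟩ := key n' hn'
    have h2 : (t : k) ^ ((n * p + 1) * p ^ (x + y')) = (t : k) ^ ((n' * p + 1) * p ^ (x' + y)) := by
      rw [pow_add, pow_add, ← mul_assoc, ← mul_assoc, pow_mul, pow_mul _ _ (p ^ y), pow_mul, h,
        pow_mul, h', ← pow_mul, ← pow_mul, mul_comm]
    exact eq_of_mul_pow_eq hpp
      (injective_pow_iff_not_isOfFinOrder.2 ht (Units.ext (by simpa using h2)))
  obtain ⟨n, hn⟩ := hfin.exists
  refine ⟨_, pow_ne_zero _ t.ne_zero, fun h => ht ?_, hn⟩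
  rw [isOfFinOrder_pow, Units.isOfFinOrder_val] at h
  exact h.resolve_right (Nat.succ_ne_zero _)

lemma exists_generic_set [IsAlgClosed k] (p : ℕ) [ExpChar k p] {t : kˣ} (ht : ¬ IsOfFinOrder t)
    {m : ℕ} (hm : 5 ≤ m) {S : Set k} (hS : S.Finite) :
    ∃ A : Finset (OnePoint k), A.card = m ∧ CrossRatioGeneric A ∧ OnePoint.infty ∈ A ∧
      FrobRigid p A ∧ ∃ a ∈ crossRatioSet A, ∀ s ∈ S, FrobIndep p a s := by
  classical
  have : Infinite k := IsAlgClosed.instInfinite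
  obtain ⟨a, ha0, ha, haS⟩ := exists_frobIndep p ht hS
  -- the cross-ratio of `∞, 0, 1, a` is `a`
  let A₀ : Finset (OnePoint k) :=
    {OnePoint.infty, ((0 : k) : OnePoint k), ((1 : k) : OnePoint k), (a : OnePoint k)}
  obtain ⟨A, hA₀, hcard, hg⟩ := exists_crossRatioGeneric_superset
    (crossRatioGeneric_of_card_le (A := A₀) Finset.card_le_four) (m := m)
    (Finset.card_le_four.trans (by omega))
  have h0 : ((0 : k) : OnePoint k) ∈ A := hA₀ (by simp [A₀])
  have h1 : ((1 : k) : OnePoint k) ∈ A := hA₀ (by simp [A₀])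
  have hi : (OnePoint.infty : OnePoint k) ∈ A := hA₀ (by simp [A₀])
  have ha1 : a ≠ 1 := by rintro rfl; exact ha IsOfFinOrder.one
  have hac : a ∈ crossRatioSet A := by
    refine ⟨![OnePoint.infty, ((0 : k) : OnePoint k), ((1 : k) : OnePoint k), (a : OnePoint k)],
      ?_, ?_, ?_⟩
    · intro i j hij
      fin_cases i <;> fin_cases j <;> simp_all [OnePoint.infty_ne_coe, eq_comm]
    · intro i
      refine hA₀ ?_
      fin_cases i <;> simp [A₀]
    · simp [crossRatio, bracket]
  exact ⟨A, hcard, hg, hi, frobRigid_of_generic p (hcard ▸ hm) hg h0 h1 hi hac ha0 ha, a, hac, haS⟩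

/-- A family of sets of `m` punctures, all containing the point at infinity, such that no power of
Frobenius followed by a Möbius map relates two of them, or one of them to itself, except for the
identity. -/
structure IsGenericFamily {d : ℕ} (p m : ℕ) (Δ : Fin d → Finset (OnePoint k)) : Prop where
  card_eq : ∀ j, (Δ j).card = m
  infty_mem : ∀ j, OnePoint.infty ∈ Δ j
  frobRigid : ∀ j, FrobRigid p (Δ j)
  noFrobCover : ∀ i j, i ≠ j → NoFrobCover p (Δ i) (Δ j)

/-- The sets are chosen one after the other, each with a cross-ratio that is unrelated, up to
iterated `p`-th powers, to all cross-ratios of the sets chosen before. -/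
theorem exists_generic_family [IsAlgClosed k] (p : ℕ) [ExpChar k p] {t : kˣ} (ht : ¬ IsOfFinOrder t)
    {m : ℕ} (hm : 5 ≤ m) (d : ℕ) :
    ∃ Δ : Fin d → Finset (OnePoint k),
      IsGenericFamily p m Δ ∧ ∀ j, CrossRatioGeneric (Δ j) := by
  induction d with
  | zero => exact ⟨Fin.elim0, ⟨fun j => j.elim0, fun j => j.elim0, fun j => j.elim0,
      fun j => j.elim0⟩, fun j => j.elim0⟩
  | succ d ih =>
    obtain ⟨Δ, hΔ, hgen⟩ := ih
    obtain ⟨A, hA, hg, hi, hr, a, ha, haS⟩ := exists_generic_set p ht hm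
      (S := ⋃ j, crossRatioSet (Δ j)) (Set.finite_iUnion fun j => finite_crossRatioSet _)
    have haS' : ∀ j, ∀ s ∈ crossRatioSet (Δ j), FrobIndep p a s := fun j s hs =>
      haS s (Set.mem_iUnion.2 ⟨j, hs⟩)
    refine ⟨Fin.cons A Δ, ⟨Fin.cases hA hΔ.card_eq, Fin.cases hi hΔ.infty_mem,
      Fin.cases hr hΔ.frobRigid, fun i j => ?_⟩, Fin.cases hg hgen⟩
    refine Fin.cases ?_ (fun i => ?_) i <;> refine Fin.cases ?_ (fun j => ?_) j
    · intro h; exact absurd rfl h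
    · intro _
      exact noFrobCover_of_frobIndep_right p (hA.trans (hΔ.card_eq j).symm) ha (haS' j)
    · intro _; exact noFrobCover_of_frobIndep_left p ha (haS' i)
    · intro h; exact hΔ.noFrobCover i j fun hij => h (congrArg _ hij)

end Family

/-! ### Regular functions restricted to coordinate lines -/

section RegularFunctions

open Polynomial

variable {k : Type u} [Field k] {d : ℕ}

/-- The rational points `x` of affine space with `x j ∉ Δ j` for all `j` and with coordinate sum
outside `S`. When every `Δ j` contains the point at infinity, these are the rational points of the
product of the punctured lines outside the hyperplanes `∑ j, x j = s` with `s ∈ S`. -/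
def InDom (Δ : Fin d → Finset (OnePoint k)) (S : Finset k) (x : Fin d → k) : Prop :=
  (∀ j, (x j : OnePoint k) ∉ Δ j) ∧ ∑ j, x j ∉ S

/-- Restriction of a polynomial to the line through `x` in the `j`-th coordinate direction. -/
def lineHom (j : Fin d) (x : Fin d → k) : MvPolynomial (Fin d) k →ₐ[k] k[X] :=
  MvPolynomial.aeval (Function.update (fun l => C (x l)) j X)

lemma eval_lineHom (j : Fin d) (x : Fin d → k) (P : MvPolynomial (Fin d) k) (a : k) :
    (lineHom j x P).eval a = MvPolynomial.eval (Function.update x j a) P := by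
  have : (Polynomial.aeval a).comp (lineHom j x) =
      MvPolynomial.aeval (Function.update x j a) := by
    refine MvPolynomial.algHom_ext fun l => ?_
    rcases eq_or_ne l j with rfl | h
    · simp [lineHom]
    · simp [lineHom, h]
  have := DFunLike.congr_fun this P
  simpa [MvPolynomial.aeval_eq_eval] using this

lemma natDegree_lineHom_le (j : Fin d) (x : Fin d → k) (P : MvPolynomial (Fin d) k) :
    (lineHom j x P).natDegree ≤ P.totalDegree := by
  have := MvPolynomial.aeval_natDegree_le P le_rfl (Function.update (fun l => C (x l)) j X) (n := 1)
    (fun l => by rcases eq_or_ne l j with rfl | h <;> simp [*])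
  simpa [lineHom] using this

lemma sum_update_eq (x : Fin d → k) (j : Fin d) (a : k) :
    ∑ l, Function.update x j a l = a + (∑ l, x l - x j) := by
  rw [Finset.sum_update_of_mem (Finset.mem_univ j), ← Finset.add_sum_erase _ _ (Finset.mem_univ j),
    add_sub_cancel_left, Finset.sdiff_singleton_eq_erase]

/-- The parameters `a` at which the line through `x` in the `j`-th coordinate direction meets
`Δ j` or one of the hyperplanes `∑ l, x l = s` with `s ∈ S`. -/
def lineExcluded [DecidableEq k] (Δ : Fin d → Finset (OnePoint k)) (S : Finset k) (j : Fin d)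
    (x : Fin d → k) : Finset k :=
  (Δ j).preimage (↑) OnePoint.coe_injective.injOn ∪ S.image (· - (∑ l, x l - x j))

variable {Δ : Fin d → Finset (OnePoint k)} {S : Finset k}

lemma inDom_update [DecidableEq k] {j : Fin d} {x : Fin d → k}
    (hx : ∀ l, l ≠ j → (x l : OnePoint k) ∉ Δ l) {a : k} (ha : a ∉ lineExcluded Δ S j x) :
    InDom Δ S (Function.update x j a) := by
  simp only [lineExcluded, Finset.mem_union, Finset.mem_preimage, Finset.mem_image, not_or] at ha
  refine ⟨fun l => ?_, fun h => ha.2 ⟨_, h, ?_⟩⟩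
  · rcases eq_or_ne l j with rfl | hl
    · simpa using ha.1
    · simpa [hl] using hx l hl
  · rw [sum_update_eq]; ring

lemma eventually_inDom_update {j : Fin d} {x : Fin d → k}
    (hx : ∀ l, l ≠ j → (x l : OnePoint k) ∉ Δ l) :
    ∀ᶠ a in Filter.cofinite, InDom Δ S (Function.update x j a) := by
  classical
  filter_upwards [(lineExcluded Δ S j x).finite_toSet.compl_mem_cofinite] with a ha
  exact inDom_update hx ha

lemma card_lineExcluded_add_one_le [DecidableEq k] {j : Fin d} (x : Fin d → k)
    (hi : OnePoint.infty ∈ Δ j) :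
    (lineExcluded Δ S j x).card + 1 ≤ (Δ j).card + S.card := by
  classical
  have h1 : ((Δ j).preimage (fun a : k => (a : OnePoint k)) OnePoint.coe_injective.injOn).card + 1 ≤
      (Δ j).card := by
    rw [← Finset.card_erase_add_one hi, ← Finset.card_image_of_injective _ OnePoint.coe_injective]
    refine Nat.add_le_add_right (Finset.card_le_card fun y hy => ?_) 1
    obtain ⟨a, ha, rfl⟩ := Finset.mem_image.1 hy
    exact Finset.mem_erase.2 ⟨OnePoint.coe_ne_infty a, Finset.mem_preimage.1 ha⟩
  have h2 := Finset.card_union_le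
    ((Δ j).preimage (fun a : k => (a : OnePoint k)) OnePoint.coe_injective.injOn)
    (S.image (· - (∑ l, x l - x j)))
  have h3 : (S.image (· - (∑ l, x l - x j))).card ≤ S.card := Finset.card_image_le
  rw [lineExcluded]
  refine (Nat.add_le_add_right h2 1).trans ?_
  omega

/-- No cross-ratio of `e` with three different points of `A` has a `q`-th power, for a power
`q ≤ Q` of `p`, that is a cross-ratio of points of `B`. Consequently no power of Frobenius of that
size followed by a Möbius map sends `e` and three different points of `A`, all different from `e`,
into `B`. -/
def IsGeneral (p Q : ℕ) (A B : Finset (OnePoint k)) (e : k) : Prop :=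
  ∀ q ∈ Set.Iic Q, ∀ b ∈ {b : Fin 4 → OnePoint k | ∀ i, b i ∈ B},
    ∀ t ∈ {t : Fin 3 → OnePoint k | ∀ i, t i ∈ A},
    (∃ r, q = p ^ r) → Function.Injective t → (e : OnePoint k) ≠ t 2 →
    crossRatio (Fin.cons (e : OnePoint k) t : Fin 4 → OnePoint k) ^ q ≠ crossRatio b

/-- Finitely many conditions are imposed, and each excludes at most one point. -/
lemma eventually_isGeneral (p Q : ℕ) [ExpChar k p] (A B : Finset (OnePoint k)) :
    ∀ᶠ e in Filter.cofinite, IsGeneral p Q A B e := by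
  unfold IsGeneral
  rw [Filter.eventually_all_finite (Set.finite_Iic Q)]
  intro q _
  rw [Filter.eventually_all_finite (finite_tuples 4 B)]
  intro b _
  rw [Filter.eventually_all_finite (finite_tuples 3 A)]
  intro t _
  by_cases h : (∃ r, q = p ^ r) ∧ Function.Injective t
  · obtain ⟨⟨r, rfl⟩, ht⟩ := h
    refine Set.Subsingleton.finite fun a ha c hc => ?_
    simp only [Set.mem_compl_iff, Set.mem_ofPred_eq, not_forall, not_not] at ha hc
    obtain ⟨-, -, ha, hac⟩ := ha
    obtain ⟨-, -, hc, hcc⟩ := hc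
    refine OnePoint.coe_injective (crossRatio_cons_injOn ht ha hc ?_)
    exact iterateFrobenius_inj k p r (by simpa [iterateFrobenius_def] using hac.trans hcc.symm)
  · exact .of_forall fun a h1 h2 => absurd ⟨h1, h2⟩ h

variable [IsAlgClosed k]

/-- Restricted to a general line in the `j`-th coordinate direction, a regular function that
avoids the values in `Δ i` is constant, or it is the coordinate and `j = i`. On the line it omits
the `m` values in `Δ i` outside at most `m + 1` points of the affine line, so it is constant or a
power of Frobenius followed by a Möbius map, and every point of `Δ i` is the image of a puncture
of the line. By generality of the line no puncture coming from `S` is involved; then the map sends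
`Δ j` onto `Δ i`, so that `j = i` and it is the identity. -/
theorem lineHom_eq_or (p : ℕ) [ExpChar k p] {m : ℕ} (hm : 5 ≤ m)
    (hfam : IsGenericFamily p m Δ) (hS : S.card ≤ 2)
    {P H : MvPolynomial (Fin d) k} (hH : ∀ x, InDom Δ S x → MvPolynomial.eval x H ≠ 0) {i : Fin d}
    (hP : ∀ x, InDom Δ S x → ∀ a : k, (a : OnePoint k) ∈ Δ i →
      MvPolynomial.eval x P ≠ a * MvPolynomial.eval x H)
    (j : Fin d) {x : Fin d → k} (hx : ∀ l, l ≠ j → (x l : OnePoint k) ∉ Δ l)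
    (hgen : ∀ s ∈ S, IsGeneral p (max P.totalDegree H.totalDegree) (Δ j) (Δ i)
      (s - (∑ l, x l - x j))) :
    (∃ c, lineHom j x P = C c * lineHom j x H) ∨ (j = i ∧ lineHom j x P = X * lineHom j x H) := by
  classical
  obtain ⟨hΔ, hi, hrig, hcov⟩ := hfam
  have : Infinite k := IsAlgClosed.instInfinite
  have hdom : ∀ a, a ∉ lineExcluded Δ S j x → InDom Δ S (Function.update x j a) := fun a =>
    inDom_update hx
  have hcardE := card_lineExcluded_add_one_le (S := S) x (hi j)
  obtain ⟨a₀, ha₀⟩ := (lineExcluded Δ S j x).exists_notMem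
  rcases eq_const_or_frobenius_linear p (Δ i) (by rw [hΔ]; omega) (lineExcluded Δ S j x)
    (by rw [hΔ] at hcardE ⊢; omega) (P := lineHom j x P) (h := lineHom j x H)
    (fun h0 => hH _ (hdom a₀ ha₀) (by rw [← eval_lineHom, h0, eval_zero]))
    (fun a ha => by
      by_contra hcon
      exact hH _ (hdom a hcon) (by rw [← eval_lineHom, ha]))
    (fun a ha c hc => by
      rw [eval_lineHom, eval_lineHom]
      exact hP _ (hdom a ha) c hc) with h | ⟨r, α, β, γ, δ, hdet, hq, heq, himg⟩
  · exact .inl h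
  right
  have hqQ : p ^ r ≤ max P.totalDegree H.totalDegree :=
    hq.trans (max_le_max (natDegree_lineHom_le _ _ _) (natDegree_lineHom_le _ _ _))
  choose τ hτE hτ using himg
  have hτinj : ∀ b hb c hc, τ b hb = τ c hc → b = c := fun b hb c hc hbc => by
    have h1 := hτ b hb
    rw [hbc] at h1
    exact h1.eq_of_eq p (hτ c hc)
  have hτE' : ∀ b hb, τ b hb ∈ Δ j ∨
      ∃ s ∈ S, τ b hb = ((s - (∑ l, x l - x j) : k) : OnePoint k) := by
    intro b hb
    rcases hτE b hb with h | ⟨e, he, h⟩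
    · exact .inl (h ▸ hi j)
    · rw [h]
      rcases Finset.mem_union.1 he with he | he
      · exact .inl (Finset.mem_preimage.1 he)
      · obtain ⟨s, hs, rfl⟩ := Finset.mem_image.1 he
        exact .inr ⟨s, hs, rfl⟩
  -- otherwise the cross-ratio of such a puncture and three points of `Δ j` contradicts generality
  have hall : ∀ b hb, τ b hb ∈ Δ j := by
    intro b₀ hb₀
    by_contra hcon
    obtain ⟨s, hs, he⟩ := (hτE' b₀ hb₀).resolve_left hcon
    -- at least three points of `Δ i` have their preimage in `Δ j`
    have hcard : 3 ≤ ((Δ i).attach.filter fun b => τ b.1 b.2 ∈ Δ j).card := by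
      have h1 := Finset.card_filter_add_card_filter_not (s := (Δ i).attach)
        (fun b => τ b.1 b.2 ∈ Δ j)
      have h2 : ((Δ i).attach.filter fun b => ¬ τ b.1 b.2 ∈ Δ j).card ≤ S.card := by
        refine (Finset.card_le_card_of_injOn (fun b => τ b.1 b.2)
          (t := S.image fun s => ((s - (∑ l, x l - x j) : k) : OnePoint k)) ?_ ?_).trans
          Finset.card_image_le
        · intro b hb
          obtain ⟨s, hs, h⟩ := (hτE' b.1 b.2).resolve_left (Finset.mem_filter.1 hb).2
          exact Finset.mem_image.2 ⟨s, hs, h.symm⟩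
        · intro b _ c _ hbc
          exact Subtype.ext (hτinj _ _ _ _ hbc)
      rw [Finset.card_attach, hΔ] at h1
      omega
    obtain ⟨T, hT, hT3⟩ := Finset.exists_subset_card_eq hcard
    let e := (T.equivFinOfCardEq hT3).symm
    have hmem : ∀ n, τ (e n).1.1 (e n).1.2 ∈ Δ j := fun n => (Finset.mem_filter.1 (hT (e n).2)).2
    refine hgen s hs (p ^ r) hqQ (Fin.cons b₀ fun n => (e n).1.1) ?_
      (fun n => τ (e n).1.1 (e n).1.2) hmem ⟨r, rfl⟩ ?_ ?_ ?_
    · exact Fin.cases hb₀ fun n => (e n).1.2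
    · intro n n' h
      exact e.injective (Subtype.ext (Subtype.ext (hτinj _ _ _ _ h)))
    · rw [← he]
      exact fun h => hcon (h ▸ hmem 2)
    · refine (crossRatio_of_isFrobImage p hdet ?_).symm
      refine Fin.cases ?_ fun n => ?_
      · simpa [← he] using hτ b₀ hb₀
      · simpa using hτ (e n).1.1 (e n).1.2
  have hcover : ∀ b ∈ Δ i, ∃ y ∈ Δ j, IsFrobImage (p ^ r) α β γ δ y b := fun b hb =>
    ⟨τ b hb, hall b hb, hτ b hb⟩
  have hji : j = i := by
    by_contra hji
    exact hcov j i hji r α β γ δ hdet hcover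
  subst hji
  obtain ⟨hr, rfl, rfl, rfl⟩ := hrig j r α β γ δ hdet hcover
  refine ⟨rfl, ?_⟩
  have hα : α ≠ 0 := by rintro rfl; simp at hdet
  rw [hr, pow_one] at heq
  refine mul_right_cancel₀ (C_ne_zero.2 hα) ?_
  simp only [map_zero, zero_mul, zero_add, add_zero] at heq
  rw [heq]; ring

/-- A regular function on the product of the punctured lines, with at most two hyperplanes
removed, that avoids the values in `Δ i` is constant or the `i`-th coordinate. The function is
given as `P / H` with `H` invertible on the domain. -/
theorem regular_eq_const_or_coord (p : ℕ) [ExpChar k p] {m : ℕ} (hm : 5 ≤ m)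
    (hfam : IsGenericFamily p m Δ) (hS : S.card ≤ 2) (hSd : S = ∅ ∨ 2 ≤ d)
    {P H : MvPolynomial (Fin d) k} (hH : ∀ x, InDom Δ S x → MvPolynomial.eval x H ≠ 0) {i : Fin d}
    (hP : ∀ x, InDom Δ S x → ∀ a : k, (a : OnePoint k) ∈ Δ i →
      MvPolynomial.eval x P ≠ a * MvPolynomial.eval x H) :
    (∃ c, ∀ x, InDom Δ S x → MvPolynomial.eval x P = c * MvPolynomial.eval x H) ∨
      ∀ x, InDom Δ S x → MvPolynomial.eval x P = x i * MvPolynomial.eval x H := by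
  classical
  have : Infinite k := IsAlgClosed.instInfinite
  let f : (Fin d → k) → k := fun x => MvPolynomial.eval x P / MvPolynomial.eval x H
  have hline := fun j x => lineHom_eq_or p hm hfam hS hH hP j (x := x)
  have hgenl : ∀ (j l : Fin d), l ≠ j → ∀ x : Fin d → k, ∀ᶠ t in Filter.cofinite, ∀ s ∈ S,
      IsGeneral p (max P.totalDegree H.totalDegree) (Δ j) (Δ i)
        (s - (∑ l', Function.update x l t l' - Function.update x l t j)) := by
    intro j l hl x
    rw [Filter.eventually_all_finset]
    intro s _
    simp only [sum_update_eq, Function.update_of_ne hl.symm]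
    refine Function.Injective.tendsto_cofinite (f := fun t => s - (t + (∑ l, x l - x l) - x j)) ?_
      |>.eventually (eventually_isGeneral p _ (Δ j) (Δ i))
    intro t t' h
    simpa using h
  -- `f` does not depend on the coordinates other than the `i`-th
  have hstep : ∀ j, j ≠ i → ∀ x, InDom Δ S x → ∀ a, InDom Δ S (Function.update x j a) →
      f x = f (Function.update x j a) := by
    intro j hj x hx a ha
    have hgood : ∀ y : Fin d → k, InDom Δ S y → InDom Δ S (Function.update y j a) →
        (∀ s ∈ S, IsGeneral p (max P.totalDegree H.totalDegree) (Δ j) (Δ i)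
          (s - (∑ l, y l - y j))) →
        MvPolynomial.eval y P * MvPolynomial.eval (Function.update y j a) H =
          MvPolynomial.eval (Function.update y j a) P * MvPolynomial.eval y H := by
      intro y hy hya hs
      obtain ⟨c, hc⟩ := (hline j y (fun l _ => hy.1 l) hs).resolve_right fun h => hj h.1
      have e1 := congrArg (eval (y j)) hc
      have e2 := congrArg (eval a) hc
      simp only [eval_mul, eval_C, eval_lineHom, Function.update_eq_self] at e1 e2
      rw [e1, e2]; ring
    have key : MvPolynomial.eval x P * MvPolynomial.eval (Function.update x j a) H =
        MvPolynomial.eval (Function.update x j a) P * MvPolynomial.eval x H := by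
      -- move the `i`-th coordinate to a general position
      let F : k[X] := lineHom i x P * lineHom i (Function.update x j a) H -
        lineHom i (Function.update x j a) P * lineHom i x H
      have hF : F = 0 := by
        by_contra hF0
        have hroots : ∀ᶠ t in Filter.cofinite, F.eval t ≠ 0 := by
          refine (F.rootSet_finite k).subset fun t ht => ?_
          rw [mem_rootSet]
          exact ⟨hF0, by simpa using ht⟩
        obtain ⟨t, ht, h1, h2, h3⟩ := (hroots.and ((eventually_inDom_update (S := S) (j := i)
          fun l _ => hx.1 l).and ((eventually_inDom_update (S := S) (j := i)
          fun l _ => ha.1 l).and (hgenl j i hj.symm x)))).exists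
        refine ht ?_
        rw [Function.update_comm hj] at h2
        have := hgood _ h1 h2 h3
        simp only [F, eval_sub, eval_mul, eval_lineHom]
        rw [Function.update_comm hj, this, sub_self]
      have := congrArg (eval (x i)) hF
      simp only [F, eval_sub, eval_mul, eval_lineHom, Function.update_eq_self, eval_zero] at this
      have hupd : Function.update (Function.update x j a) i (x i) = Function.update x j a := by
        rw [Function.update_comm hj, Function.update_eq_self]
      rw [hupd, sub_eq_zero] at this
      exact this
    simp only [f]
    rw [div_eq_div_iff (hH x hx) (hH _ ha), key]
  -- change the coordinates in `T` one after the other, through common general values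
  have hpath : ∀ T : Finset (Fin d), i ∉ T → ∀ x y, InDom Δ S x → InDom Δ S y →
      (∀ l ∉ T, x l = y l) → f x = f y := by
    intro T
    induction T using Finset.induction_on with
    | empty => intro _ x y _ _ h; rw [show x = y from funext fun l => h l (by simp)]
    | insert j T hj ih =>
      intro hiT x y hx hy h
      have hji : j ≠ i := fun h => hiT (h ▸ Finset.mem_insert_self _ _)
      obtain ⟨t, h1, h2⟩ := ((eventually_inDom_update (S := S) (j := j) fun l _ => hx.1 l).and
        (eventually_inDom_update (S := S) (j := j) fun l _ => hy.1 l)).exists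
      rw [hstep j hji x hx t h1, hstep j hji y hy t h2]
      refine ih (fun h => hiT (Finset.mem_insert_of_mem h)) _ _ h1 h2 fun l hl => ?_
      rcases eq_or_ne l j with rfl | hlj
      · simp
      · simpa [hlj] using h l (by simp [hlj, hl])
  have hpath' : ∀ x y, InDom Δ S x → InDom Δ S y → x i = y i → f x = f y := fun x y hx hy h =>
    hpath (Finset.univ.erase i) (by simp) x y hx hy fun l hl => by
      rw [show l = i by simpa using hl, h]
  -- on a general line in the `i`-th direction, `f` is constant or the coordinate
  have hdich : ∀ y, InDom Δ S y → ∃ y', InDom Δ S y' ∧ y' i = y i ∧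
      ((∃ c, ∀ a, InDom Δ S (Function.update y' i a) → f (Function.update y' i a) = c) ∨
        ∀ a, InDom Δ S (Function.update y' i a) → f (Function.update y' i a) = a) := by
    intro y hy
    obtain ⟨y', hy', hyi, hs⟩ : ∃ y', InDom Δ S y' ∧ y' i = y i ∧
        ∀ s ∈ S, IsGeneral p (max P.totalDegree H.totalDegree) (Δ i) (Δ i)
          (s - (∑ l, y' l - y' i)) := by
      rcases hSd with rfl | hd
      · exact ⟨y, hy, rfl, by simp⟩
      · have : Nontrivial (Fin d) := Fin.nontrivial_iff_two_le.2 hd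
        obtain ⟨l, hl⟩ := exists_ne i
        obtain ⟨t, h1, h2⟩ := ((eventually_inDom_update (S := S) (j := l) fun l' _ => hy.1 l').and
          (hgenl i l hl y)).exists
        -- moving the line sideways moves its intersections with the hyperplanes
        exact ⟨_, h1, Function.update_of_ne hl.symm _ _, h2⟩
    refine ⟨y', hy', hyi, (hline i y' (fun l _ => hy'.1 l) hs).imp ?_ ?_⟩
    · rintro ⟨c, hc⟩
      refine ⟨c, fun a ha => ?_⟩
      have := congrArg (eval a) hc
      simp only [eval_mul, eval_C, eval_lineHom] at this
      simp only [f]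
      rw [this, mul_div_cancel_right₀ _ (hH _ ha)]
    · rintro ⟨-, hc⟩ a ha
      have := congrArg (eval a) hc
      simp only [eval_mul, eval_X, eval_lineHom] at this
      simp only [f]
      rw [this, mul_div_cancel_right₀ _ (hH _ ha)]
  suffices h : (∃ c, ∀ x, InDom Δ S x → f x = c) ∨ ∀ x, InDom Δ S x → f x = x i by
    refine h.imp (fun ⟨c, h⟩ => ⟨c, fun x hx => ?_⟩) fun h x hx => ?_
    · exact (div_eq_iff (hH x hx)).1 (h x hx)
    · exact (div_eq_iff (hH x hx)).1 (h x hx)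
  -- `f` is a function of `x i` alone, so the same alternative holds on all lines
  by_cases hconst : ∃ y, InDom Δ S y ∧ ∃ c, ∀ a, InDom Δ S (Function.update y i a) →
      f (Function.update y i a) = c
  · left
    obtain ⟨y, hy, c, hc⟩ := hconst
    refine ⟨c, fun x hx => ?_⟩
    obtain ⟨x', hx', hxi, hx''⟩ := hdich x hx
    have hev := (eventually_inDom_update (S := S) (j := i) fun l _ => hy.1 l).and
      (eventually_inDom_update (S := S) (j := i) fun l _ => hx'.1 l)
    have heq : ∀ a, InDom Δ S (Function.update y i a) → InDom Δ S (Function.update x' i a) →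
        f (Function.update x' i a) = c := fun a h1 h2 => by
      rw [← hc a h1]; exact hpath' _ _ h2 h1 (by simp)
    rcases hx'' with ⟨c', hc'⟩ | hid
    · obtain ⟨a, h1, h2⟩ := hev.exists
      have hx0 := hc' (x' i) (by rwa [Function.update_eq_self])
      rw [Function.update_eq_self] at hx0
      rw [hpath' x x' hx hx' hxi.symm, hx0, ← hc' a h2, heq a h1 h2]
    · exfalso
      obtain ⟨a, ⟨h1, h2⟩, h3⟩ := (hev.and (Set.finite_singleton c).compl_mem_cofinite).exists
      exact h3 ((hid a h2).symm.trans (heq a h1 h2))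
  · right
    intro x hx
    obtain ⟨x', hx', hxi, ⟨c, hc⟩ | hid⟩ := hdich x hx
    · exact absurd ⟨x', hx', c, hc⟩ hconst
    · have := hid (x' i) (by rwa [Function.update_eq_self])
      rw [Function.update_eq_self] at this
      rw [hpath' x x' hx hx' hxi.symm, this, hxi]

end RegularFunctions

/-! ### Coordinate rings -/

section CoordRing

open Polynomial

variable {k : Type u} [Field k] {d : ℕ}

/-- The polynomial whose zeros are the points of `A` in the affine line; the point at infinity
contributes the factor `-1`. -/
def pointsPoly (A : Finset (OnePoint k)) : k[X] :=
  ∏ p ∈ A, (C (homCoord p 1) * X - C (homCoord p 0))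

/-- The polynomial whose nonvanishing locus in affine space is the domain `InDom Δ S`. -/
def domainPoly (Δ : Fin d → Finset (OnePoint k)) (S : Finset k) : MvPolynomial (Fin d) k :=
  (∏ j, Polynomial.aeval (MvPolynomial.X j) (pointsPoly (Δ j))) *
    ∏ s ∈ S, (∑ j, MvPolynomial.X j - MvPolynomial.C s)

lemma aeval_pointsPoly {B : Type*} [CommRing B] [Algebra k B] (A : Finset (OnePoint k)) (b : B) :
    Polynomial.aeval b (pointsPoly A) =
      ∏ p ∈ A, (algebraMap k B (homCoord p 1) * b - algebraMap k B (homCoord p 0)) := by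
  simp [pointsPoly, map_prod]

lemma aeval_domainPoly {B : Type*} [CommRing B] [Algebra k B] (Δ : Fin d → Finset (OnePoint k))
    (S : Finset k) (b : Fin d → B) :
    MvPolynomial.aeval b (domainPoly Δ S) =
      (∏ j, Polynomial.aeval (b j) (pointsPoly (Δ j))) *
        ∏ s ∈ S, (∑ j, b j - algebraMap k B s) := by
  simp only [domainPoly, map_mul, map_prod, map_sub, map_sum, MvPolynomial.aeval_X,
    ← Polynomial.aeval_algHom_apply]
  simp

lemma aeval_pointsPoly_ne_zero_iff {A : Finset (OnePoint k)} {a : k} :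
    Polynomial.aeval a (pointsPoly A) ≠ 0 ↔ (a : OnePoint k) ∉ A := by
  rw [aeval_pointsPoly, Finset.prod_ne_zero_iff]
  have : ∀ p : OnePoint k, algebraMap k k (homCoord p 1) * a - algebraMap k k (homCoord p 0) =
      bracket (a : OnePoint k) p := fun p => by
    simp only [bracket, homCoord_coe_one, homCoord_coe_zero, Algebra.algebraMap_self,
      RingHom.id_apply]
    ring
  simp only [this, ne_eq, bracket_eq_zero_iff]
  exact ⟨fun h ha => h _ ha rfl, fun h p hp hap => h (hap ▸ hp)⟩

lemma eval_domainPoly_ne_zero_iff {Δ : Fin d → Finset (OnePoint k)} {S : Finset k} {x : Fin d → k} :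
    MvPolynomial.eval x (domainPoly Δ S) ≠ 0 ↔ InDom Δ S x := by
  rw [← MvPolynomial.aeval_eq_eval, aeval_domainPoly, mul_ne_zero_iff,
    Finset.prod_ne_zero_iff, Finset.prod_ne_zero_iff, InDom]
  simp only [Finset.mem_univ, true_implies, aeval_pointsPoly_ne_zero_iff, Algebra.algebraMap_self,
    RingHom.id_apply, sub_ne_zero]
  exact and_congr_right fun _ => ⟨fun h hs => h _ hs rfl, fun h s hs hx => h (hx ▸ hs)⟩

/-- The domain is empty for `d = 0` and `0 ∈ S`, as the coordinate sum is then `0` at the only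
point. -/
lemma exists_inDom [Infinite k] (Δ : Fin d → Finset (OnePoint k)) {S : Finset k}
    (hS : S = ∅ ∨ 2 ≤ d) : ∃ x, InDom Δ S x := by
  have h1 : ∀ j, ∃ a : k, (a : OnePoint k) ∉ Δ j := fun j => by
    obtain ⟨a, ha⟩ := ((Δ j).preimage (fun a : k => (a : OnePoint k))
      OnePoint.coe_injective.injOn).exists_notMem
    exact ⟨a, by simpa using ha⟩
  choose x hx using h1
  rcases hS with rfl | hd
  · exact ⟨x, hx, by simp⟩
  · exact ((eventually_inDom_update (S := S) (j := (⟨0, by omega⟩ : Fin d)) (x := x)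
      fun l _ => hx l).exists).imp' _ fun _ h => h

/-- The coordinate ring of the domain `InDom Δ S`. -/
abbrev coordRing (Δ : Fin d → Finset (OnePoint k)) (S : Finset k) : Type u :=
  Localization.Away (domainPoly Δ S)

variable {Δ : Fin d → Finset (OnePoint k)} {S : Finset k}

variable (Δ S) in
/-- The `j`-th coordinate function. -/
def coord (j : Fin d) : coordRing Δ S :=
  algebraMap (MvPolynomial (Fin d) k) (coordRing Δ S) (MvPolynomial.X j)

/-- The homomorphism given by the images of the coordinate functions. The coordinate ring
represents the functor of tuples at which `domainPoly Δ S` is invertible. -/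
def coordRingLift {B : Type*} [CommRing B] [Algebra k B] (b : Fin d → B)
    (hb : IsUnit (MvPolynomial.aeval b (domainPoly Δ S))) : coordRing Δ S →ₐ[k] B :=
  IsLocalization.liftAlgHom (M := Submonoid.powers (domainPoly Δ S)) (f := MvPolynomial.aeval b) (by
    rintro ⟨_, n, rfl⟩
    simpa using hb.pow n)

lemma coordRingLift_algebraMap {B : Type*} [CommRing B] [Algebra k B] (b : Fin d → B)
    (hb : IsUnit (MvPolynomial.aeval b (domainPoly Δ S))) (P : MvPolynomial (Fin d) k) :
    coordRingLift b hb (algebraMap _ (coordRing Δ S) P) = MvPolynomial.aeval b P := by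
  simp [coordRingLift]

@[simp]
lemma coordRingLift_coord {B : Type*} [CommRing B] [Algebra k B] (b : Fin d → B)
    (hb : IsUnit (MvPolynomial.aeval b (domainPoly Δ S))) (j : Fin d) :
    coordRingLift b hb (coord Δ S j) = b j := by
  simp [coordRingLift, coord]

lemma coordRing_algHom_ext {B : Type*} [CommRing B] [Algebra k B] {f g : coordRing Δ S →ₐ[k] B}
    (h : ∀ j, f (coord Δ S j) = g (coord Δ S j)) : f = g := by
  refine IsLocalization.algHom_ext (Submonoid.powers (domainPoly Δ S)) ?_
  exact MvPolynomial.algHom_ext h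

lemma map_aeval_coord {B : Type*} [CommRing B] [Algebra k B] (f : coordRing Δ S →ₐ[k] B) :
    IsUnit (MvPolynomial.aeval (fun j => f (coord Δ S j)) (domainPoly Δ S)) := by
  have h := (IsLocalization.Away.algebraMap_isUnit (S := coordRing Δ S) (domainPoly Δ S)).map f
  have h2 : (MvPolynomial.aeval fun j => f (coord Δ S j)) =
      f.comp (IsScalarTower.toAlgHom k (MvPolynomial (Fin d) k) (coordRing Δ S)) :=
    MvPolynomial.algHom_ext fun j => by simp [coord]
  rw [h2]
  exact h

/-- The value of a regular function at a rational point. -/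
def evalAt {x : Fin d → k} (hx : InDom Δ S x) : coordRing Δ S →ₐ[k] k :=
  coordRingLift x (by
    rw [MvPolynomial.aeval_eq_eval]; exact (eval_domainPoly_ne_zero_iff.2 hx).isUnit)

@[simp]
lemma evalAt_coord {x : Fin d → k} (hx : InDom Δ S x) (j : Fin d) :
    evalAt hx (coord Δ S j) = x j := by
  simp [evalAt]

lemma evalAt_mk {x : Fin d → k} (hx : InDom Δ S x) {f : coordRing Δ S} {P : MvPolynomial (Fin d) k}
    {n : ℕ} (hf : f * algebraMap _ (coordRing Δ S) (domainPoly Δ S ^ n) = algebraMap _ _ P) :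
    evalAt hx f * MvPolynomial.eval x (domainPoly Δ S ^ n) = MvPolynomial.eval x P := by
  have := congrArg (evalAt hx) hf
  rwa [map_mul, evalAt, coordRingLift_algebraMap, coordRingLift_algebraMap,
    MvPolynomial.aeval_eq_eval] at this

lemma exists_eq_mk (f : coordRing Δ S) : ∃ (P : MvPolynomial (Fin d) k) (n : ℕ),
    f * algebraMap _ (coordRing Δ S) (domainPoly Δ S ^ n) = algebraMap _ _ P := by
  obtain ⟨⟨P, _, n, rfl⟩, h⟩ := IsLocalization.surj (Submonoid.powers (domainPoly Δ S)) f
  exact ⟨P, n, h⟩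

lemma domainPoly_ne_zero (hne : ∃ x, InDom Δ S x) : domainPoly Δ S ≠ 0 := by
  obtain ⟨x, hx⟩ := hne
  intro h
  have := eval_domainPoly_ne_zero_iff.2 hx
  simp [h] at this

/-- Regular functions are determined by their values at rational points. -/
lemma coordRing_ext [Infinite k] (hne : ∃ x, InDom Δ S x) {f g : coordRing Δ S}
    (h : ∀ x (hx : InDom Δ S x), evalAt hx f = evalAt hx g) : f = g := by
  rw [← sub_eq_zero]
  obtain ⟨P, n, hP⟩ := exists_eq_mk (f - g)
  have hu : IsUnit (algebraMap _ (coordRing Δ S) (domainPoly Δ S ^ n)) := by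
    rw [map_pow]
    exact (IsLocalization.Away.algebraMap_isUnit (domainPoly Δ S)).pow n
  have hPG : P * domainPoly Δ S = 0 := by
    refine MvPolynomial.funext fun x => ?_
    rw [map_mul, map_zero]
    by_cases hx : InDom Δ S x
    · rw [← evalAt_mk hx hP, map_sub, h x hx, sub_self, zero_mul, zero_mul]
    · rw [not_not.1 (mt eval_domainPoly_ne_zero_iff.1 hx), mul_zero]
  rw [(mul_eq_zero.1 hPG).resolve_right (domainPoly_ne_zero hne), map_zero] at hP
  exact (hu.mul_left_eq_zero).1 hP

/-- A regular function on the domain that takes values in the `i`-th punctured line is constant or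
the `i`-th coordinate. -/
theorem coordRing_eq_algebraMap_or_coord [IsAlgClosed k] (p : ℕ) [ExpChar k p] {m : ℕ} (hm : 5 ≤ m)
    (hΔ : IsGenericFamily p m Δ) (hS : S.card ≤ 2) (hSd : S = ∅ ∨ 2 ≤ d)
    {i : Fin d} {f : coordRing Δ S} (hf : IsUnit (Polynomial.aeval f (pointsPoly (Δ i)))) :
    (∃ c, f = algebraMap k _ c) ∨ f = coord Δ S i := by
  have : Infinite k := IsAlgClosed.instInfinite
  have hne := exists_inDom Δ hSd
  obtain ⟨P, n, hP⟩ := exists_eq_mk f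
  have hH : ∀ x, InDom Δ S x → MvPolynomial.eval x (domainPoly Δ S ^ n) ≠ 0 := fun x hx => by
    rw [map_pow]; exact pow_ne_zero _ (eval_domainPoly_ne_zero_iff.2 hx)
  refine (regular_eq_const_or_coord p hm hΔ hS hSd hH (P := P) (i := i) ?_).imp ?_ ?_
  · intro x hx a ha h
    rw [← evalAt_mk hx hP] at h
    have h1 := (hf.map (evalAt hx)).ne_zero
    rw [← Polynomial.aeval_algHom_apply, mul_right_cancel₀ (hH x hx) h] at h1
    exact aeval_pointsPoly_ne_zero_iff.1 h1 ha
  · rintro ⟨c, hc⟩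
    refine ⟨c, coordRing_ext hne fun x hx => ?_⟩
    rw [AlgHom.commutes]
    exact mul_right_cancel₀ (hH x hx) ((evalAt_mk hx hP).trans (hc x hx))
  · intro hc
    refine coordRing_ext hne fun x hx => ?_
    rw [evalAt_coord]
    exact mul_right_cancel₀ (hH x hx) ((evalAt_mk hx hP).trans (hc x hx))

/-- The coordinate ring of the affine line with the points of `A` removed; when `A` contains the
point at infinity, this is the coordinate ring of the complement of `A` in the projective line. -/
abbrev curveRing (A : Finset (OnePoint k)) : Type u := Localization.Away (pointsPoly A)

/-- The coordinate function of the curve. -/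
def curveCoord (A : Finset (OnePoint k)) : curveRing A := algebraMap k[X] (curveRing A) X

/-- The homomorphism given by the image of the coordinate function. -/
def curveRingLift {A : Finset (OnePoint k)} {B : Type*} [CommRing B] [Algebra k B] (b : B)
    (hb : IsUnit (Polynomial.aeval b (pointsPoly A))) : curveRing A →ₐ[k] B :=
  IsLocalization.liftAlgHom (M := Submonoid.powers (pointsPoly A)) (f := Polynomial.aeval b) (by
    rintro ⟨_, n, rfl⟩
    simpa using hb.pow n)

@[simp]
lemma curveRingLift_coord {A : Finset (OnePoint k)} {B : Type*} [CommRing B] [Algebra k B] (b : B)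
    (hb : IsUnit (Polynomial.aeval b (pointsPoly A))) :
    curveRingLift b hb (curveCoord A) = b := by
  simp [curveRingLift, curveCoord]

lemma curveRing_algHom_ext {A : Finset (OnePoint k)} {B : Type*} [CommRing B] [Algebra k B]
    {f g : curveRing A →ₐ[k] B} (h : f (curveCoord A) = g (curveCoord A)) : f = g := by
  refine IsLocalization.algHom_ext (Submonoid.powers (pointsPoly A)) ?_
  exact Polynomial.algHom_ext h

lemma isUnit_aeval_curveCoord {A : Finset (OnePoint k)} {B : Type*} [CommRing B] [Algebra k B]
    (f : curveRing A →ₐ[k] B) :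
    IsUnit (Polynomial.aeval (f (curveCoord A)) (pointsPoly A)) := by
  have h := (IsLocalization.Away.algebraMap_isUnit (S := curveRing A) (pointsPoly A)).map f
  have h2 : Polynomial.aeval (f (curveCoord A)) =
      f.comp (IsScalarTower.toAlgHom k k[X] (curveRing A)) :=
    Polynomial.algHom_ext (by simp [curveCoord])
  rw [h2]
  exact h

end CoordRing

/-! ### Affine schemes over a field and their products -/

section AffineSchemes
variable {k : Type u} [Field k]

/-- The affine `k`-scheme `Spec A`. -/
def specAlg (A : Type u) [CommRing A] [Algebra k A] : Over (SpecOf k) :=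
  Over.mk (Spec.map (CommRingCat.ofHom (algebraMap k A)))

variable {A B D : Type u} [CommRing A] [Algebra k A] [CommRing B] [Algebra k B] [CommRing D]
  [Algebra k D]

/-- The morphism of affine `k`-schemes given by a homomorphism of `k`-algebras. -/
def specAlgMap (f : A →ₐ[k] B) : (specAlg B : Over (SpecOf k)) ⟶ specAlg A :=
  Over.homMk (Spec.map (CommRingCat.ofHom f.toRingHom)) (by
    change Spec.map _ ≫ Spec.map _ = Spec.map _
    rw [← Spec.map_comp, ← CommRingCat.ofHom_comp]
    congr 2
    exact f.comp_algebraMap)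

lemma specAlgMap_surjective (φ : (specAlg B : Over (SpecOf k)) ⟶ specAlg A) :
    ∃ f : A →ₐ[k] B, φ = specAlgMap f := by
  obtain ⟨g, hg⟩ := Spec.map_surjective φ.left
  have hw := Over.w φ
  rw [← hg] at hw
  change Spec.map g ≫ Spec.map _ = Spec.map _ at hw
  rw [← Spec.map_comp] at hw
  have := Spec.map_injective hw
  let f : A →ₐ[k] B := { g.hom with commutes' := fun c => congrArg (fun h => h.hom c) this }
  refine ⟨f, Over.OverMorphism.ext ?_⟩
  exact hg.symm

lemma specAlgMap_comp (f : A →ₐ[k] B) (g : B →ₐ[k] D) :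
    (specAlgMap (g.comp f) : (specAlg D : Over (SpecOf k)) ⟶ specAlg A) =
      specAlgMap g ≫ specAlgMap f := by
  refine Over.OverMorphism.ext ?_
  change Spec.map _ = Spec.map _ ≫ Spec.map _
  rw [← Spec.map_comp]
  rfl

lemma specAlgMap_id :
    (specAlgMap (AlgHom.id k A) : (specAlg A : Over (SpecOf k)) ⟶ specAlg A) = 𝟙 _ := by
  refine Over.OverMorphism.ext ?_
  change Spec.map (𝟙 _) = 𝟙 _
  exact Spec.map_id _

/-- A homomorphism of `k`-algebras that factors through `k` gives a constant morphism. -/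
lemma isConstant_specAlgMap (f : A →ₐ[k] k) :
    IsConstant (specAlgMap ((Algebra.ofId k B).comp f) :
      (specAlg B : Over (SpecOf k)) ⟶ specAlg A) := by
  let e : (Over.mk (𝟙 (SpecOf k)) : Over (SpecOf k)) ⟶ specAlg k :=
    Over.homMk (𝟙 _) (by
      change 𝟙 _ ≫ Spec.map (𝟙 _) = 𝟙 _
      rw [Spec.map_id, Category.comp_id])
  refine ⟨e ≫ specAlgMap f, ?_⟩
  rw [constMor, specAlgMap_comp, ← Category.assoc]
  congr 1

lemma isAffine_specAlg : IsAffine (specAlg A : Over (SpecOf k)).left :=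
  inferInstanceAs (IsAffine (Spec (CommRingCat.of A)))

lemma IsConstant.comp_right {X Y Z : Over (SpecOf k)} {f : X ⟶ Y} (hf : IsConstant f) (g : Y ⟶ Z) :
    IsConstant (f ≫ g) := by
  obtain ⟨y, rfl⟩ := hf
  exact ⟨y ≫ g, by simp [constMor]⟩

lemma IsConstant.comp_left {X Y Z : Over (SpecOf k)} {g : Y ⟶ Z} (hg : IsConstant g) (f : X ⟶ Y) :
    IsConstant (f ≫ g) := by
  obtain ⟨z, rfl⟩ := hg
  refine ⟨z, ?_⟩
  rw [constMor, constMor, ← Category.assoc]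
  congr 1
  exact Over.OverMorphism.ext (by simp)

lemma IsSmoothAffineVarietyOfDim.of_iso {X Y : Over (SpecOf k)} {d : ℕ} (e : X ≅ Y)
    (hX : IsSmoothAffineVarietyOfDim X d) : IsSmoothAffineVarietyOfDim Y d := by
  have hw : e.inv.left ≫ X.hom = Y.hom := Over.w e.inv
  obtain ⟨⟨h1, h2, h3, h4⟩, h5, h6, h7⟩ := hX
  have : IsIso e.inv.left := inferInstanceAs (IsIso ((Over.forget _).map e.inv))
  refine ⟨⟨?_, ?_, ?_, ?_⟩, ?_, ?_, ?_⟩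
  · exact isReduced_of_isOpenImmersion e.inv.left
  · rw [← hw]; infer_instance
  · rw [← hw]; infer_instance
  · rw [← hw]; infer_instance
  · exact .of_isIso e.inv.left
  · rw [← hw]; infer_instance
  · rw [← h7]
    exact IsHomeomorph.topologicalKrullDim_eq _ (e.inv.left.homeomorph.isHomeomorph)

section Product
variable {d : ℕ} (Δ : Fin d → Finset (OnePoint k))

/-- The homomorphism of coordinate rings that corresponds to the `j`-th projection. -/
def curveInclusion (j : Fin d) : curveRing (Δ j) →ₐ[k] coordRing Δ ∅ :=
  curveRingLift (coord Δ ∅ j) (by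
    have h := map_aeval_coord (AlgHom.id k (coordRing Δ ∅))
    rw [aeval_domainPoly, Finset.prod_empty, mul_one] at h
    exact isUnit_of_dvd_unit (Finset.dvd_prod_of_mem
      (fun j => Polynomial.aeval (coord Δ ∅ j) (pointsPoly (Δ j))) (Finset.mem_univ j)) h)

/-- The spectrum of `coordRing Δ ∅` is the product of the spectra of the rings `curveRing (Δ j)`:
by the universal properties of both rings `coordRing Δ ∅` is their coproduct, and `Spec` turns
coproducts of `k`-algebras into products of `k`-schemes. -/
def isLimitFanCoordRing :
    IsLimit (Fan.mk (specAlg (coordRing Δ ∅) : Over (SpecOf k))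
      fun j => specAlgMap (curveInclusion Δ j)) := by
  let G : Fin d → (CommAlgCat.{u} (CommRingCat.of k))ᵒᵖ := fun j =>
    .op (CommAlgCat.of (CommRingCat.of k) (curveRing (Δ j)))
  let π : ∀ j, Opposite.op (CommAlgCat.of (CommRingCat.of k) (coordRing Δ ∅)) ⟶ G j := fun j =>
    (CommAlgCat.ofHom (R := CommRingCat.of k) (curveInclusion Δ j)).op
  have hlim : IsLimit (Fan.mk _ π) := by
    have hb : ∀ (s : Fan G), IsUnit (MvPolynomial.aeval
        (fun j => (s.proj j).unop.hom (curveCoord (Δ j)) : Fin d → s.pt.unop)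
        (domainPoly Δ ∅)) := by
      intro s
      rw [aeval_domainPoly, Finset.prod_empty, mul_one]
      refine (Finset.prod_induction _ IsUnit (fun _ _ h h' => h.mul h') isUnit_one ?_)
      intro j _
      exact isUnit_aeval_curveCoord (k := k) (B := s.pt.unop) (s.proj j).unop.hom
    refine Fan.IsLimit.mk _ (fun s => (CommAlgCat.ofHom (R := CommRingCat.of k)
      (coordRingLift (k := k) (B := s.pt.unop) _ (hb s))).op) ?_ ?_
    · intro s j
      refine Quiver.Hom.unop_inj (CommAlgCat.hom_ext ?_)
      refine curveRing_algHom_ext (k := k) ?_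
      change coordRingLift _ (hb s) (curveInclusion Δ j (curveCoord (Δ j))) = _
      rw [curveInclusion, curveRingLift_coord, coordRingLift_coord]
    · intro s m hm
      refine Quiver.Hom.unop_inj (CommAlgCat.hom_ext ?_)
      refine coordRing_algHom_ext (k := k) fun j => ?_
      change m.unop.hom _ = coordRingLift _ (hb s) _
      rw [coordRingLift_coord, ← hm j]
      change _ = m.unop.hom (curveInclusion Δ j (curveCoord (Δ j)))
      rw [curveInclusion, curveRingLift_coord]
  have : PreservesLimitsOfSize.{0, 0} (algSpec (CommRingCat.of k)) :=
    preservesLimitsOfSize_algSpec (R := CommRingCat.of k)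
  exact isLimitFanMkObjOfIsLimit (algSpec (CommRingCat.of k)) G π hlim

end Product
end AffineSchemes

/-! ### Smoothness and dimension -/

section SmoothDim
variable {k : Type u} [Field k] {d : ℕ} {Δ : Fin d → Finset (OnePoint k)} {S : Finset k}

lemma smooth_coordRing : Algebra.Smooth k (coordRing Δ S) :=
  have : Algebra.Smooth k (MvPolynomial (Fin d) k) := { }
  have : Algebra.Smooth (MvPolynomial (Fin d) k) (coordRing Δ S) :=
    .of_isLocalization_Away (domainPoly Δ S)
  .comp k (MvPolynomial (Fin d) k) _

/-- Restriction of polynomials to the linear subspace on which the first `r` coordinates agree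
with those of `x`. The kernels form the chain of primes that computes the dimension at `x`. -/
def flagHom (x : Fin d → k) (r : ℕ) : MvPolynomial (Fin d) k →ₐ[k] MvPolynomial (Fin d) k :=
  MvPolynomial.aeval fun i => if i.1 < r then MvPolynomial.C (x i) else MvPolynomial.X i

lemma flagHom_comp (x : Fin d → k) {r s : ℕ} (h : r ≤ s) (P : MvPolynomial (Fin d) k) :
    flagHom x s (flagHom x r P) = flagHom x s P := by
  have : (flagHom x s).comp (flagHom x r) = flagHom x s := by
    refine MvPolynomial.algHom_ext fun i => ?_
    by_cases hi : i.1 < r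
    · simp [flagHom, hi, hi.trans_le h]
    · simp [flagHom, hi]
  exact DFunLike.congr_fun this P

lemma eval_flagHom (x : Fin d → k) (r : ℕ) (P : MvPolynomial (Fin d) k) :
    MvPolynomial.eval x (flagHom x r P) = MvPolynomial.eval x P := by
  have : (MvPolynomial.aeval x).comp (flagHom x r) = MvPolynomial.aeval x := by
    refine MvPolynomial.algHom_ext fun i => ?_
    by_cases hi : i.1 < r <;> simp [flagHom, hi]
  simpa [MvPolynomial.aeval_eq_eval] using DFunLike.congr_fun this P

/-- The upper bound is that of the polynomial ring. For the lower bound, the flag of linear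
subspaces through a rational point of the domain gives a chain of `d + 1` primes. -/
theorem ringKrullDim_coordRing (hne : ∃ x, InDom Δ S x) : ringKrullDim (coordRing Δ S) = d := by
  refine le_antisymm ?_ ?_
  · refine (Order.krullDim_le_of_strictMono (PrimeSpectrum.comap
      (algebraMap (MvPolynomial (Fin d) k) (coordRing Δ S))) ?_).trans_eq ?_
    · refine Monotone.strictMono_of_injective (fun p q h => Ideal.comap_mono h) ?_
      exact PrimeSpectrum.localization_comap_injective _ (Submonoid.powers (domainPoly Δ S))
    · change ringKrullDim (MvPolynomial (Fin d) k) = d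
      rw [MvPolynomial.ringKrullDim_of_isNoetherianRing]
      simp
  · obtain ⟨x, hx⟩ := hne
    have hdisj : ∀ r, Disjoint (Submonoid.powers (domainPoly Δ S) : Set (MvPolynomial (Fin d) k))
        (RingHom.ker (flagHom x r) : Ideal (MvPolynomial (Fin d) k)) := by
      intro r
      rw [Set.disjoint_left]
      rintro _ ⟨n, rfl⟩ hP
      rw [SetLike.mem_coe, RingHom.mem_ker] at hP
      have h1 := eval_flagHom x r (domainPoly Δ S ^ n)
      rw [hP, map_zero, map_pow] at h1
      exact pow_ne_zero n (eval_domainPoly_ne_zero_iff.2 hx) h1.symm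
    let e := IsLocalization.orderIsoOfPrime (Submonoid.powers (domainPoly Δ S)) (coordRing Δ S)
    let I : Fin (d + 1) → {q : Ideal (MvPolynomial (Fin d) k) // q.IsPrime ∧
        Disjoint (Submonoid.powers (domainPoly Δ S) : Set (MvPolynomial (Fin d) k)) q} := fun r =>
      ⟨RingHom.ker (flagHom x r), RingHom.ker_isPrime _, hdisj r⟩
    have hI : StrictMono I := by
      refine Fin.strictMono_iff_lt_succ.2 fun r => ?_
      rw [← Subtype.coe_lt_coe]
      refine lt_of_le_of_ne (fun P hP => ?_) fun h => ?_
      · have hP' : flagHom x r.castSucc P = 0 := hP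
        change flagHom x r.succ P = 0
        rw [← flagHom_comp x (show r.castSucc.1 ≤ r.succ.1 by simp), hP', map_zero]
      · have h1 : (MvPolynomial.X r - MvPolynomial.C (x r) : MvPolynomial (Fin d) k) ∈
            (I r.succ).1 := by
          change flagHom x r.succ _ = 0
          simp [flagHom]
        rw [← h] at h1
        have h2 : flagHom x r.castSucc
          (MvPolynomial.X r - MvPolynomial.C (x r) : MvPolynomial (Fin d) k) = 0 := h1
        simp only [flagHom, map_sub, MvPolynomial.aeval_X, Fin.val_castSucc, lt_irrefl, if_false,
          MvPolynomial.algHom_C, MvPolynomial.algebraMap_eq] at h2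
        have h3 := congrArg (MvPolynomial.eval (Function.update x r (x r + 1))) h2
        simp at h3
    let f : Fin (d + 1) → PrimeSpectrum (coordRing Δ S) := fun r =>
      ⟨(e.symm (I r)).1, (e.symm (I r)).2⟩
    have hf : StrictMono f := fun r s h => e.symm.strictMono (hI h)
    exact Order.le_krullDim_iff.2 ⟨LTSeries.mk d f hf, rfl⟩

theorem isSmoothAffineVarietyOfDim_specAlg_coordRing (hne : ∃ x, InDom Δ S x) :
    IsSmoothAffineVarietyOfDim (specAlg (coordRing Δ S) : Over (SpecOf k)) d := by
  have : IsDomain (coordRing Δ S) := IsLocalization.isDomain_localization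
    (powers_le_nonZeroDivisors_of_noZeroDivisors (domainPoly_ne_zero hne))
  have := smooth_coordRing (Δ := Δ) (S := S)
  have haff : IsAffineHom (specAlg (coordRing Δ S) : Over (SpecOf k)).hom :=
    inferInstanceAs (IsAffineHom (Spec.map _))
  refine ⟨⟨?_, inferInstance, ?_, inferInstance⟩, isAffine_specAlg, ?_, ?_⟩
  · exact inferInstanceAs (IsReduced (Spec (CommRingCat.of (coordRing Δ S))))
  · refine (HasRingHomProperty.Spec_iff (P := @LocallyOfFiniteType)).2 ?_
    exact RingHom.finiteType_algebraMap.2 inferInstance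
  · refine (HasRingHomProperty.Spec_iff (P := @Smooth)).2 ?_
    exact RingHom.smooth_algebraMap.2 inferInstance
  · rw [← ringKrullDim_coordRing hne]
    exact PrimeSpectrum.topologicalKrullDim_eq_ringKrullDim _

end SmoothDim

/-! ### The punctured projective line is affine -/

section PuncturedLine

open Polynomial HomogeneousLocalization

variable {k : Type u} [Field k] (Δ : Finset (OnePoint k))

/-- The form in two variables whose zeros on the projective line are the points of `Δ`. -/
def pointsForm : MvPolynomial (Fin 2) k := ∏ p ∈ Δ, linForm p

lemma pointsForm_mem : pointsForm Δ ∈ grading k Δ.card := by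
  rw [pointsForm, MvPolynomial.mem_homogeneousSubmodule, Finset.card_eq_sum_ones]
  refine MvPolynomial.IsHomogeneous.prod _ _ _ fun p _ => ?_
  refine MvPolynomial.IsHomogeneous.sub ?_ ?_
  · exact (MvPolynomial.isHomogeneous_C_mul_X _ _)
  · exact (MvPolynomial.isHomogeneous_C_mul_X _ _)

lemma aeval_pointsForm : MvPolynomial.aeval ![X, 1] (pointsForm Δ) = pointsPoly Δ := by
  rw [pointsForm, pointsPoly, map_prod]
  refine Finset.prod_congr rfl fun p _ => ?_
  simp [linForm]

lemma pointsPoly_ne_zero : pointsPoly Δ ≠ 0 := by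
  rw [pointsPoly, Finset.prod_ne_zero_iff]
  intro p _ h
  induction p using OnePoint.rec with
  | infty => simp at h
  | coe a => simp [X_sub_C_ne_zero] at h

variable {Δ} in
/-- The point at infinity contributes to the number of points, but not to the degree. This is what
makes room for clearing denominators in `dehomogenize_surjective`. -/
lemma natDegree_pointsPoly_lt (hi : OnePoint.infty ∈ Δ) : (pointsPoly Δ).natDegree < Δ.card := by
  classical
  rw [pointsPoly, ← Finset.mul_prod_erase _ _ hi]
  simp only [homCoord_infty_one, homCoord_infty_zero, map_zero, zero_mul, map_one, zero_sub,
    neg_mul, one_mul, natDegree_neg]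
  rw [← Finset.card_erase_add_one hi, Nat.lt_succ_iff]
  refine (natDegree_prod_le _ _).trans ?_
  rw [Finset.card_eq_sum_ones]
  refine Finset.sum_le_sum fun p _ => ?_
  exact (natDegree_sub_le _ _).trans (max_le
    ((natDegree_C_mul_le _ _).trans natDegree_X_le) (by simp))

/-- The degree-zero part of the homogeneous localization away from the points of `Δ` maps to the
coordinate ring of the curve by `x₀ ↦ X`, `x₁ ↦ 1`. -/
def dehomogenize : Away (grading k) (pointsForm Δ) →+* curveRing Δ :=
  (IsLocalization.map (M := Submonoid.powers (pointsForm Δ))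
    (S := Localization (Submonoid.powers (pointsForm Δ)))
    (T := Submonoid.powers (pointsPoly Δ)) (curveRing Δ)
    (MvPolynomial.aeval ![X, 1] : MvPolynomial (Fin 2) k →ₐ[k] k[X]).toRingHom (by
      rw [Submonoid.powers_le, Submonoid.mem_comap]
      exact ⟨1, by simpa using (aeval_pointsForm Δ).symm⟩)).comp
    (algebraMap (Away (grading k) (pointsForm Δ)) (Localization (Submonoid.powers (pointsForm Δ))))

lemma dehomogenize_mk (n : ℕ) (a : MvPolynomial (Fin 2) k) (ha : a ∈ grading k (n • Δ.card)) :
    dehomogenize Δ (Away.mk (grading k) (pointsForm_mem Δ) n a ha) *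
      algebraMap k[X] (curveRing Δ) (pointsPoly Δ ^ n) =
        algebraMap k[X] (curveRing Δ) (MvPolynomial.aeval ![X, 1] a) := by
  rw [dehomogenize, RingHom.comp_apply, HomogeneousLocalization.algebraMap_apply,
    Away.val_mk, Localization.mk_eq_mk',
    IsLocalization.map_mk', ← IsLocalization.mk'_spec (curveRing Δ)
      (MvPolynomial.aeval ![X, 1] a : k[X])
      (⟨pointsPoly Δ ^ n, n, rfl⟩ : Submonoid.powers (pointsPoly Δ))]
  congr 2
  simp only [AlgHom.toRingHom_eq_coe, RingHom.coe_coe, map_pow, aeval_pointsForm]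

lemma algebraMap_curveRing_injective : Function.Injective (algebraMap k[X] (curveRing Δ)) :=
  IsLocalization.injective _ (powers_le_nonZeroDivisors_of_noZeroDivisors (pointsPoly_ne_zero Δ))

lemma isUnit_algebraMap_pointsPoly_pow (n : ℕ) :
    IsUnit (algebraMap k[X] (curveRing Δ) (pointsPoly Δ ^ n)) := by
  rw [map_pow]
  exact (IsLocalization.Away.algebraMap_isUnit (pointsPoly Δ)).pow n

lemma dehomogenize_injective : Function.Injective (dehomogenize Δ) := by
  rw [injective_iff_map_eq_zero]
  intro z hz
  obtain ⟨n, a, ha, rfl⟩ := Away.mk_surjective (grading k) (pointsForm_mem Δ) z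
  have h := dehomogenize_mk Δ n a ha
  rw [hz, zero_mul, eq_comm, ← map_zero (algebraMap k[X] (curveRing Δ))] at h
  have h2 := homogenize_eq_of_isHomogeneous ((MvPolynomial.mem_homogeneousSubmodule _ _).1 ha)
    (algebraMap_curveRing_injective Δ h)
  rw [homogenize_zero] at h2
  subst h2
  exact mk_eq_zero_of_num _ rfl

variable {Δ} in
lemma dehomogenize_surjective (hi : OnePoint.infty ∈ Δ) : Function.Surjective (dehomogenize Δ) := by
  intro z
  obtain ⟨⟨P, _, n, rfl⟩, h⟩ := IsLocalization.surj (Submonoid.powers (pointsPoly Δ)) z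
  -- enlarge the denominator until the numerator can be homogenized in the same degree
  let s := P.natDegree
  have hdeg : (P * pointsPoly Δ ^ s).natDegree ≤ (n + s) • Δ.card := by
    have h1 := natDegree_mul_le (p := P) (q := pointsPoly Δ ^ s)
    have h2 := natDegree_pow_le (p := pointsPoly Δ) (n := s)
    obtain ⟨c, hc⟩ := Nat.exists_eq_add_of_lt (natDegree_pointsPoly_lt hi)
    rw [smul_eq_mul, hc]
    nlinarith [Nat.zero_le (n * ((pointsPoly Δ).natDegree + c + 1)), Nat.zero_le (s * c)]
  refine ⟨Away.mk (grading k) (pointsForm_mem Δ) (n + s)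
    (homogenize (P * pointsPoly Δ ^ s) ((n + s) • Δ.card))
    ((MvPolynomial.mem_homogeneousSubmodule _ _).2 (isHomogeneous_homogenize _)), ?_⟩
  refine (isUnit_algebraMap_pointsPoly_pow Δ (n + s)).mul_right_cancel ?_
  rw [dehomogenize_mk, aeval_homogenize_X_one _ hdeg, map_mul, ← h, pow_add, map_mul, mul_assoc]

lemma dehomogenize_fromZeroRingHom (c : k) :
    dehomogenize Δ (fromZeroRingHom (grading k) _ (algebraMap k (grading k 0) c)) =
      algebraMap k (curveRing Δ) c := by
  have h : fromZeroRingHom (grading k) (Submonoid.powers (pointsForm Δ))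
      (algebraMap k (grading k 0) c) =
      Away.mk (grading k) (pointsForm_mem Δ) 0 (MvPolynomial.C c) (by
        rw [zero_smul]; exact MvPolynomial.isHomogeneous_C _ c) := by
    refine HomogeneousLocalization.val_injective _ ?_
    rw [Away.val_mk, ← HomogeneousLocalization.algebraMap_eq,
      ← HomogeneousLocalization.algebraMap_apply,
      ← IsScalarTower.algebraMap_apply (grading k 0) (Away (grading k) (pointsForm Δ))]
    simp only [pow_zero]
    exact (Localization.mk_one_eq_algebraMap _).symm
  have h2 := dehomogenize_mk Δ 0 (MvPolynomial.C c) (by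
        rw [zero_smul]; exact MvPolynomial.isHomogeneous_C _ c)
  rw [pow_zero, map_one, mul_one, ← h] at h2
  rw [h2]
  simp [IsScalarTower.algebraMap_apply k k[X] (curveRing Δ)]

variable {Δ} in
/-- The projective line punctured in a set that contains the point at infinity is affine, with
coordinate ring `curveRing Δ`; this is an isomorphism over `k`. -/
def puncturedLineIso (hi : OnePoint.infty ∈ Δ) : puncturedLine Δ ≅ specAlg (curveRing Δ) :=
  have hpos : 0 < Δ.card := Finset.card_pos.2 (Finset.nonempty_def.2 ⟨_, hi⟩)
  let e : Away (grading k) (pointsForm Δ) ≃+* curveRing Δ :=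
    RingEquiv.ofBijective (dehomogenize Δ) ⟨dehomogenize_injective Δ, dehomogenize_surjective hi⟩
  let b := Proj.basicOpenIsoSpec (grading k) (pointsForm Δ) (pointsForm_mem Δ) hpos
  have h : Spec.map (CommRingCat.ofHom e.symm.toRingHom) ≫
      Spec.map (CommRingCat.ofHom (algebraMap k (curveRing Δ))) =
      b.inv ≫ (Proj.basicOpen (grading k) (pointsForm Δ)).ι ≫ Proj.toSpecZero (grading k) ≫
        Spec.map (CommRingCat.ofHom (algebraMap k (grading k 0))) := by
    rw [Proj.basicOpenIsoSpec_inv_ι_assoc, Proj.awayι_toSpecZero_assoc, ← Spec.map_comp,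
      ← Spec.map_comp, ← CommRingCat.ofHom_comp, ← CommRingCat.ofHom_comp]
    congr 2
    refine RingHom.ext fun c => ?_
    refine (congrArg e.symm (dehomogenize_fromZeroRingHom Δ c).symm).trans ?_
    exact e.symm_apply_apply _
  Over.isoMk (b ≪≫ Scheme.Spec.mapIso e.symm.toCommRingCatIso.op)
    ((Category.assoc _ _ _).trans ((Iso.inv_comp_eq b).1 h.symm).symm)

end PuncturedLine

/-! ### Endomorphisms -/

section Main
variable {k : Type u} [Field k] {d : ℕ} {Δ : Fin d → Finset (OnePoint k)} {S : Finset k}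

/-- A morphism is constant if the corresponding homomorphism takes constant values, which are then
its values at any rational point. -/
lemma isConstant_specAlgMap_of_eq_evalAt {A : Type u} [CommRing A] [Algebra k A]
    {g : A →ₐ[k] coordRing Δ S}
    (hne : ∃ x, InDom Δ S x)
    (h : ∀ x (hx : InDom Δ S x), g = (Algebra.ofId k _).comp ((evalAt hx).comp g)) :
    IsConstant (specAlgMap g : (specAlg (coordRing Δ S) : Over (SpecOf k)) ⟶ _) := by
  obtain ⟨x, hx⟩ := hne
  rw [h x hx]
  exact isConstant_specAlgMap _

/-- The set is `{0, t}`, where `t` is not a difference of two elements of any `Δ j`: then no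
translate of it is contained in `Δ j`. -/
lemma exists_sub_notMem [Infinite k] (Δ : Fin d → Finset (OnePoint k)) :
    ∃ S : Finset k, S.card ≤ 2 ∧ ∀ j, ∀ c : k, ∃ s ∈ S, ((s - c : k) : OnePoint k) ∉ Δ j := by
  classical
  let F : Fin d → Finset k := fun j => (Δ j).preimage (↑) OnePoint.coe_injective.injOn
  obtain ⟨t, ht⟩ := (Finset.univ.biUnion fun j => Finset.image₂ (· - ·) (F j) (F j)).exists_notMem
  refine ⟨{0, t}, Finset.card_le_two, fun j c => ?_⟩
  by_contra! hcon
  refine ht (Finset.mem_biUnion.2 ⟨j, Finset.mem_univ j, ?_⟩)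
  have h0 := hcon 0 (by simp)
  have h1 := hcon t (by simp)
  exact Finset.mem_image₂.2 ⟨_, Finset.mem_preimage.2 h1, _, Finset.mem_preimage.2 h0, by ring⟩

/-- The product of punctured lines is affine with coordinate ring `coordRing Δ ∅`. -/
def productIso (hi : ∀ j, OnePoint.infty ∈ Δ j) :
    (∏ᶜ fun j => puncturedLine (Δ j)) ≅ specAlg (coordRing Δ ∅) :=
  Pi.mapIso (fun j => puncturedLineIso (hi j)) ≪≫
    (limit.isLimit _).conePointUniqueUpToIso (isLimitFanCoordRing Δ)

lemma productIso_hom_comp (hi : ∀ j, OnePoint.infty ∈ Δ j) (j : Fin d) :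
    (productIso hi).hom ≫ specAlgMap (curveInclusion Δ j) =
      Pi.π _ j ≫ (puncturedLineIso (hi j)).hom := by
  have h : ((limit.isLimit _).conePointUniqueUpToIso (isLimitFanCoordRing Δ)).hom ≫
      specAlgMap (curveInclusion Δ j) = Pi.π _ j :=
    IsLimit.conePointUniqueUpToIso_hom_comp (limit.isLimit _) (isLimitFanCoordRing Δ) ⟨j⟩
  rw [productIso, Iso.trans_hom, Category.assoc, h]
  simp

variable [IsAlgClosed k]

/-- A morphism from the product to its `j`-th factor is the projection or constant; here both
schemes are presented as spectra. -/
theorem morphism_to_curve {p : ℕ} [ExpChar k p] {m : ℕ} (hm : 5 ≤ m) (hΔ : IsGenericFamily p m Δ)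
    (j : Fin d) (f : (specAlg (coordRing Δ ∅) : Over (SpecOf k)) ⟶ specAlg (curveRing (Δ j))) :
    f = specAlgMap (curveInclusion Δ j) ∨ IsConstant f := by
  have : Infinite k := IsAlgClosed.instInfinite
  obtain ⟨g, rfl⟩ := specAlgMap_surjective f
  rcases coordRing_eq_algebraMap_or_coord p hm hΔ (S := ∅) (by simp) (.inl rfl)
    (isUnit_aeval_curveCoord g) with ⟨c, hc⟩ | hc
  · refine .inr (isConstant_specAlgMap_of_eq_evalAt (exists_inDom Δ (.inl rfl)) fun x hx => ?_)
    refine curveRing_algHom_ext ?_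
    simp [hc, Algebra.ofId_apply]
  · left
    congr 1
    refine curveRing_algHom_ext ?_
    rw [hc, curveInclusion, curveRingLift_coord]

/-- The complement of the hyperplanes `∑ j, x j = s`, `s ∈ S`, in the product of punctured lines
is endo-free if, for `d ≥ 2`, no translate of `S` is contained in some `Δ j`: every component of
an endomorphism is constant or a coordinate, and if both kinds occur, then the sum of the
components takes a value in `S`. -/
theorem endoFree_specAlg_coordRing {p : ℕ} [ExpChar k p] {m : ℕ} (hm : 5 ≤ m)
    (hΔ : IsGenericFamily p m Δ) (hS : S.card ≤ 2) (hSd : S = ∅ ∨ 2 ≤ d)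
    (hSΔ : 2 ≤ d → ∀ j, ∀ c : k, ∃ s ∈ S, ((s - c : k) : OnePoint k) ∉ Δ j) :
    EndoFree (specAlg (coordRing Δ S) : Over (SpecOf k)) := by
  classical
  have : Infinite k := IsAlgClosed.instInfinite
  have hne := exists_inDom Δ hSd
  intro f
  obtain ⟨g, rfl⟩ := specAlgMap_surjective f
  have hg : ∀ i, (∃ c, g (coord Δ S i) = algebraMap k _ c) ∨ g (coord Δ S i) = coord Δ S i := by
    intro i
    refine coordRing_eq_algebraMap_or_coord p hm hΔ hS hSd ?_
    have h := map_aeval_coord g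
    rw [aeval_domainPoly] at h
    exact isUnit_of_dvd_unit (Finset.dvd_prod_of_mem
      (fun j => Polynomial.aeval (g (coord Δ S j)) (pointsPoly (Δ j))) (Finset.mem_univ i))
      (isUnit_of_mul_isUnit_left h)
  by_cases hid : ∀ i, g (coord Δ S i) = coord Δ S i
  · left
    rw [← specAlgMap_id]
    congr 1
    exact coordRing_algHom_ext hid
  right
  by_cases hconst : ∀ i, ∃ c, g (coord Δ S i) = algebraMap k _ c
  · refine isConstant_specAlgMap_of_eq_evalAt hne fun x hx => coordRing_algHom_ext fun i => ?_
    obtain ⟨c, hc⟩ := hconst i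
    simp [hc, Algebra.ofId_apply]
  -- Some component `g_i` is the `i`-th coordinate and some `g_l` is constant. The `i`-th coordinate
  -- can be chosen such that `∑ j, g_j` lies in `S`, and then `x` can be moved into the domain by
  -- changing its `l`-th coordinate, on which no component depends.
  exfalso
  push Not at hid hconst
  obtain ⟨l, hl⟩ := hid
  obtain ⟨i, hi⟩ := hconst
  have hil : i ≠ l := by
    rintro rfl
    exact ((hg i).resolve_right hl).elim hi
  have hd : 2 ≤ d := Fin.nontrivial_iff_two_le.1 ⟨i, l, hil⟩
  have hval : ∀ x (hx : InDom Δ S x), ∑ j, evalAt hx (g (coord Δ S j)) ∉ S := fun x hx => by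
    have h := map_aeval_coord ((evalAt hx).comp g)
    rw [MvPolynomial.aeval_eq_eval] at h
    exact (eval_domainPoly_ne_zero_iff.1 h.ne_zero).2
  obtain ⟨x, hx⟩ := hne
  obtain ⟨s, hs, hsi⟩ := hSΔ hd i (∑ j ∈ Finset.univ.erase i, evalAt hx (g (coord Δ S j)))
  set K := ∑ j ∈ Finset.univ.erase i, evalAt hx (g (coord Δ S j)) with hK
  obtain ⟨t, ht⟩ := (eventually_inDom_update (S := S) (j := l) (x := Function.update x i (s - K))
    (fun j _ => by
      rcases eq_or_ne j i with rfl | hj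
      · simpa using hsi
      · simpa [hj] using hx.1 j)).exists
  refine hval _ ht ?_
  have hsum : ∑ j, evalAt ht (g (coord Δ S j)) = s := by
    rw [← Finset.add_sum_erase _ _ (Finset.mem_univ i)]
    have h1 : evalAt ht (g (coord Δ S i)) = s - K := by
      rw [(hg i).resolve_left (by simpa using hi), evalAt_coord, Function.update_of_ne hil,
        Function.update_self]
    have h2 : ∑ j ∈ Finset.univ.erase i, evalAt ht (g (coord Δ S j)) = K := by
      refine Finset.sum_congr rfl fun j hj => ?_
      have hji := Finset.ne_of_mem_erase hj
      rcases hg j with ⟨c, hc⟩ | hc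
      · rw [hc, AlgHom.commutes, AlgHom.commutes]
      · have hjl : j ≠ l := by rintro rfl; exact hl hc
        rw [hc, evalAt_coord, evalAt_coord, Function.update_of_ne hjl, Function.update_of_ne hji]
    rw [h1, h2, sub_add_cancel]
  rwa [hsum]

/-- A morphism from the product of punctured lines to its `j`-th factor is the projection or
constant. -/
theorem product_morphism {p : ℕ} [ExpChar k p] {m : ℕ} (hm : 5 ≤ m) (hΔ : IsGenericFamily p m Δ)
    (j : Fin d) (f : (∏ᶜ fun j => puncturedLine (Δ j)) ⟶ puncturedLine (Δ j)) :
    f = Pi.π _ j ∨ IsConstant f := by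
  let θ := productIso hΔ.infty_mem
  let e := puncturedLineIso (hΔ.infty_mem j)
  have hf : f = θ.hom ≫ (θ.inv ≫ f ≫ e.hom) ≫ e.inv := by simp
  refine (morphism_to_curve hm hΔ j (θ.inv ≫ f ≫ e.hom)).imp (fun h => ?_) fun h => ?_
  · rw [hf, h, ← Category.assoc, productIso_hom_comp]
    simp [e]
  · rw [hf]
    exact (h.comp_right _).comp_left _

lemma exists_point (hi : ∀ j, OnePoint.infty ∈ Δ j) (j : Fin d) :
    Nonempty (Over.mk (𝟙 (SpecOf k)) ⟶ puncturedLine (Δ j)) := by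
  have : Infinite k := IsAlgClosed.instInfinite
  obtain ⟨x, hx⟩ := exists_inDom Δ (S := ∅) (.inl rfl)
  obtain ⟨y, -⟩ := isConstant_specAlgMap (B := k) ((evalAt hx).comp (curveInclusion Δ j))
  exact ⟨y ≫ (puncturedLineIso (hi j)).inv⟩

/-- The product has rational points, so each of its factors embeds as a coordinate line. -/
lemma exists_section (hi : ∀ j, OnePoint.infty ∈ Δ j) (i : Fin d) :
    ∃ σ : puncturedLine (Δ i) ⟶ ∏ᶜ fun j => puncturedLine (Δ j),
      σ ≫ Pi.π _ i = 𝟙 _ ∧ ∀ j, j ≠ i → IsConstant (σ ≫ Pi.π _ j) := by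
  classical
  have y := fun j => (exists_point hi j).some
  refine ⟨Pi.lift fun j => if h : j = i then eqToHom (by rw [h]) else constMor _ (y j), ?_, ?_⟩
  · simp
  · intro j hj
    exact ⟨y j, by simp [hj]⟩

/-- A morphism between two of the curves extends along a projection to the product, to which
`product_morphism` applies; restriction to a coordinate line recovers it. -/
theorem curve_morphism {p : ℕ} [ExpChar k p] {m : ℕ} (hm : 5 ≤ m) (hΔ : IsGenericFamily p m Δ)
    (i j : Fin d) (f : puncturedLine (Δ i) ⟶ puncturedLine (Δ j)) :
    (∃ h : i = j, f = eqToHom (by rw [h])) ∨ IsConstant f := by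
  obtain ⟨σ, hσ, hσ'⟩ := exists_section hΔ.infty_mem i
  have hf : f = σ ≫ Pi.π _ i ≫ f := by rw [← Category.assoc, hσ, Category.id_comp]
  rcases product_morphism hm hΔ j (Pi.π _ i ≫ f) with h | h
  · rw [h] at hf
    by_cases hij : i = j
    · subst hij
      exact .inl ⟨rfl, by rw [hf, hσ]; simp⟩
    · exact .inr (hf ▸ hσ' j (Ne.symm hij))
  · exact .inr (hf ▸ h.comp_left σ)

end Main

end EndoFreeVarieties

end

theorem mainTheorem4 {k : Type u} [Field k] [IsAlgClosed k]
    (hk : ∀ (F : Type u) [Field F] [Finite F] [Algebra F k], ¬ IsAlgClosure F k) :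
    (∀ d : ℕ, ∃ X : Over (EndoFreeVarieties.SpecOf k),
      EndoFreeVarieties.IsSmoothAffineVarietyOfDim X d ∧ EndoFreeVarieties.EndoFree X) ∧
    (∀ d m : ℕ, 5 ≤ m → ∃ Δ : Fin d → Finset (OnePoint k),
      (∀ j, (Δ j).card = m ∧ EndoFreeVarieties.CrossRatioGeneric (Δ j)) ∧
      (∀ j, EndoFreeVarieties.EndoFree (EndoFreeVarieties.puncturedLine (Δ j))) ∧
      (∀ i j, i ≠ j →
        ∀ f : EndoFreeVarieties.puncturedLine (Δ i) ⟶ EndoFreeVarieties.puncturedLine (Δ j),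
          EndoFreeVarieties.IsConstant f) ∧
      EndoFreeVarieties.IsSmoothAffineVarietyOfDim
        (∏ᶜ fun j => EndoFreeVarieties.puncturedLine (Δ j)) d ∧
      (∀ (φ : (∏ᶜ fun j => EndoFreeVarieties.puncturedLine (Δ j)) ⟶
            (∏ᶜ fun j => EndoFreeVarieties.puncturedLine (Δ j))) (j : Fin d),
          φ ≫ Pi.π _ j = Pi.π _ j ∨ EndoFreeVarieties.IsConstant (φ ≫ Pi.π _ j))) := by
  have : Infinite k := IsAlgClosed.instInfinite
  obtain ⟨t, ht⟩ := EndoFreeVarieties.exists_not_isOfFinOrder hk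
  obtain ⟨p, hp⟩ := ExpChar.exists k
  constructor
  · intro d
    obtain ⟨Δ, hΔ, -⟩ := EndoFreeVarieties.exists_generic_family p ht le_rfl d
    by_cases hd : 2 ≤ d
    · obtain ⟨S, hS, hSΔ⟩ := EndoFreeVarieties.exists_sub_notMem Δ
      exact ⟨_, EndoFreeVarieties.isSmoothAffineVarietyOfDim_specAlg_coordRing
        (EndoFreeVarieties.exists_inDom Δ (.inr hd)),
        EndoFreeVarieties.endoFree_specAlg_coordRing le_rfl hΔ hS (.inr hd) fun _ => hSΔ⟩
    · -- for `d ≤ 1` the product itself is endo-free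
      exact ⟨_, EndoFreeVarieties.isSmoothAffineVarietyOfDim_specAlg_coordRing
        (EndoFreeVarieties.exists_inDom Δ (S := ∅) (.inl rfl)),
        EndoFreeVarieties.endoFree_specAlg_coordRing le_rfl hΔ (by simp) (.inl rfl)
          fun h => absurd h hd⟩
  · intro d m hm
    obtain ⟨Δ, hΔ, hgen⟩ := EndoFreeVarieties.exists_generic_family p ht hm d
    refine ⟨Δ, fun j => ⟨hΔ.card_eq j, hgen j⟩, fun j f => ?_, fun i j hij f => ?_, ?_,
      fun φ j => ?_⟩
    · exact (EndoFreeVarieties.curve_morphism hm hΔ j j f).imp_left fun ⟨_, h⟩ => by simpa using h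
    · exact (EndoFreeVarieties.curve_morphism hm hΔ i j f).resolve_left fun ⟨h, _⟩ => hij h
    · exact (EndoFreeVarieties.isSmoothAffineVarietyOfDim_specAlg_coordRing
        (EndoFreeVarieties.exists_inDom Δ (.inl rfl))).of_iso
          (EndoFreeVarieties.productIso hΔ.infty_mem).symm
    · exact EndoFreeVarieties.product_morphism hm hΔ j _
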